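/- Let $m\in\mathbb N$, let $T_i<T_{i+1}$ be consecutive maturities, put $\sigma^2=T_{i+1}-T_i$, let $\rho(x)=\frac1{\sqrt{2\pi\sigma^2}}e^{-x^2/(2\sigma^2)}$ be the density of $N(0,\sigma^2)$, and write $(K\star f)(z)=\int_{\mathbb R}f(z-x)\rho(x)\,dx$. A function is called piecewise polynomial on an interval $J$ if $J$ can be cut at finitely many points (knots) so that the function is a polynomial on each remaining piece. Let $F:\mathbb R\to\mathbb R$ (the current iterate of the Bass local volatility fixed-point scheme) be piecewise polynomial and of class $C^m$ on $\mathbb R$, and let $F_{\mu_{i+1}}^{-1}$ (the inverse of the marginal distribution function at $T_{i+1}$, as used in the scheme) be piecewise polynomial and of class $C^m$ on $J$, where either $J=\mathbb R$ (the inverse is a spline extrapolated to the whole line), or $J=(0,1)$ (the inverse is given on its natural domain) and $F$ is the cumulative distribution function of a probability measure on $\mathbb R$. For $m\ge 0$ let $$\mathscr H_m=\Big\{f\in L^2_\rho(\mathbb R)\ :\ \text{the weak derivatives } f^{(\tau)},\ 1\le\tau\le m,\ \text{exist and lie in } L^2_\rho(\mathbb R)\Big\},$$ and let $Q_n(f)=\sum_{k=1}^n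 w_k f(\sigma x_k)$ be the $n$-point Gauss–Hermite quadrature rule for the weight $\rho$, where $x_1,\dots,x_n$ are the zeros of the probabilists' Hermite polynomial $He_n$ and $w_k$ is the integral against $N(0,1)$ of the $k$-th Lagrange basis polynomial on these nodes. Consider the two integrals in $$\int_{\mathbb R}\rho(y)\,F_{\mu_{i+1}}^{-1}\Big(\int_{\mathbb R}F(w-y-x)\rho(x)\,dx\Big)\,dy .$$ Then: 1. For all $w,y\in\mathbb R$ the inner integrand $x\mapsto F(w-y-x)$ lies in $\mathscr H_m$, and $$\Big|Q_n\big(F(w-y-\cdot)\big)-\int_{\mathbb R}F(w-y-x)\rho(x)\,dx\Big|=O(n^{-m/2})\quad(n\to\infty).$$ 2. $(K\star F)(z)\in J$ for every $z\in\mathbb R$; and for every $w\in\mathbb R$ the outer integrand $y\mapsto F_{\mu_{i+1}}^{-1}\big((K\star F)(w-y)\big)$ lies in $\mathscr H_m$, and $$\Big|Q_n\big(F_{\mu_{i+1}}^{-1}((K\star F)(w-\cdot))\big)-\int_{\mathbb R}F_{\mu_{i+1}}^{-1}\big((K\star F)(w-y)\big)\rho(y)\,dy\Big|=O(n^{-m/2})\quad(n\to\infty).$$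 The implied constants may depend on $m,\sigma,F,F_{\mu_{i+1}}^{-1},w,y$, but not on $n$. -/

import Mathlib

open MeasureTheory ProbabilityTheory Asymptotics
open scoped NNReal ENNReal ContDiff

noncomputable section

/-- `f` is piecewise polynomial on `J`: there is a finite set of knots such that `f` agrees with
one polynomial on every interval (of any kind) contained in `J` and free of knots. -/
def IsPiecewisePolynomialOn (f : ℝ → ℝ) (J : Set ℝ) : Prop :=
  ∃ knots : Finset ℝ, ∀ I : Set ℝ, I.OrdConnected → I ⊆ J → Disjoint I (knots : Set ℝ) →
    ∃ p : Polynomial ℝ, ∀ x ∈ I, f x = p.eval x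

/-- `f` is piecewise polynomial and of class `C^m` on `J`. -/
def IsSplineOn (m : ℕ) (f : ℝ → ℝ) (J : Set ℝ) : Prop :=
  ContDiffOn ℝ m f J ∧ IsPiecewisePolynomialOn f J

/-- `F` is the cumulative distribution function of a probability measure on the real line. -/
def IsCDF (F : ℝ → ℝ) : Prop :=
  ∃ μ : Measure ℝ, IsProbabilityMeasure μ ∧ ∀ x, F x = cdf μ x

/-- Convolution with the heat kernel at time `v`, that is, with the density `ρ` of `N(0, v)`:
`(K_v ⋆ f)(z) = ∫ f(z - x) ρ(x) dx`. -/
def heatConv (v : ℝ≥0) (f : ℝ → ℝ) (z : ℝ) : ℝ :=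
  ∫ x : ℝ, f (z - x) * gaussianPDFReal 0 v x

/-- `g` is the weak derivative of order `k` of `f` on the real line. -/
def HasWeakDeriv (k : ℕ) (f g : ℝ → ℝ) : Prop :=
  LocallyIntegrable f ∧ LocallyIntegrable g ∧
    ∀ φ : ℝ → ℝ, ContDiff ℝ ∞ φ → HasCompactSupport φ →
      ∫ x, f x * iteratedDeriv k φ x = (-1) ^ k * ∫ x, g x * φ x

/-- The Gaussian-weighted Sobolev space of order `m` with weight the density of `N(0, v)`:
`f` is in `L²(N(0, v))` and has weak derivatives of orders `1, …, m`, all in `L²(N(0, v))`. -/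
def MemGaussianSobolev (m : ℕ) (v : ℝ≥0) (f : ℝ → ℝ) : Prop :=
  MemLp f 2 (gaussianReal 0 v) ∧
    ∀ k : ℕ, 1 ≤ k → k ≤ m → ∃ g : ℝ → ℝ, HasWeakDeriv k f g ∧ MemLp g 2 (gaussianReal 0 v)

/-- The real zeros of the probabilists' Hermite polynomial of degree `n`. -/
def hermiteNodes (n : ℕ) : Finset ℝ :=
  ((Polynomial.hermite n).map (Int.castRingHom ℝ)).roots.toFinset

/-- The weight of the node `x` in the `n`-point Gauss–Hermite rule for `N(0, 1)`: the Gaussian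
integral of the Lagrange basis polynomial of `x` on the `n` nodes. -/
def gaussHermiteWeight (n : ℕ) (x : ℝ) : ℝ :=
  ∫ t, (Lagrange.basis (hermiteNodes n) id x).eval t ∂(gaussianReal 0 1)

/-- The `n`-point Gauss–Hermite quadrature of `f` for the weight `N(0, v)`: the rule for
`N(0, 1)` with its nodes scaled by the standard deviation `√v`. -/
def gaussHermite (n : ℕ) (v : ℝ≥0) (f : ℝ → ℝ) : ℝ :=
  ∑ x ∈ hermiteNodes n, gaussHermiteWeight n x * f (√(v : ℝ) * x)

end

/-!
A piecewise polynomial function of class `C^m` has `m` continuous derivatives, the last of which is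
locally Lipschitz, all with bounds of polynomial growth. This property is stable under products,
composition and Gaussian convolution, so it passes from `F` and `F_{μ_{i+1}}⁻¹` to both integrands;
that `K ⋆ F` stays inside `J` is the fact that a nonconstant average lies in the interior of the
convex hull of the values.

For such a function `g`, the `m + 1` integrations by parts `∫ f He_{k+1} dγ = ∫ f' He_k dγ` and
Bessel's inequality bound the sum of the absolute values of its normalized Hermite coefficients of
index at least `2n` by `O(n^{-m/2})`. The Hermite series of `g` converges to it everywhere and the
quadrature integrates the terms of index below `2n` exactly, so the error is at most this sum times
a bound for the quadrature of the later normalized Hermite polynomials `h_j`. The nodes satisfy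
`x² < 4n`, where Sonin's monotonicity argument gives `|h_j(x)| ≤ 2 e^{x²/4}`, and the quadrature of
`e^{x²/4}` is at most its Gaussian integral because the quadrature underestimates every monomial.
-/

/-- `f` is bounded by a multiple of a power of `1 + |x|`. -/
def PolyGrowth (f : ℝ → ℝ) : Prop :=
  ∃ C : ℝ, ∃ N : ℕ, 0 ≤ C ∧ ∀ x, |f x| ≤ C * (1 + |x|) ^ N

namespace PolyGrowth

variable {f g : ℝ → ℝ}

theorem mono (hg : PolyGrowth g) (h : ∀ x, |f x| ≤ |g x|) : PolyGrowth f := by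
  obtain ⟨C, N, hC, hg⟩ := hg
  exact ⟨C, N, hC, fun x => (h x).trans (hg x)⟩

theorem const (c : ℝ) : PolyGrowth fun _ => c := ⟨|c|, 0, abs_nonneg c, fun x => by simp⟩

theorem id : PolyGrowth fun x => x := ⟨1, 1, zero_le_one, fun x => by simp⟩

theorem mul (hf : PolyGrowth f) (hg : PolyGrowth g) : PolyGrowth fun x => f x * g x := by
  obtain ⟨C, N, hC, hf⟩ := hf
  obtain ⟨D, M, hD, hg⟩ := hg
  refine ⟨C * D, N + M, by positivity, fun x => ?_⟩
  calc |f x * g x| = |f x| * |g x| := abs_mul _ _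
    _ ≤ (C * (1 + |x|) ^ N) * (D * (1 + |x|) ^ M) :=
      mul_le_mul (hf x) (hg x) (abs_nonneg _) (by positivity)
    _ = C * D * (1 + |x|) ^ (N + M) := by ring

theorem add (hf : PolyGrowth f) (hg : PolyGrowth g) : PolyGrowth fun x => f x + g x := by
  obtain ⟨C, N, hC, hf⟩ := hf
  obtain ⟨D, M, hD, hg⟩ := hg
  refine ⟨C + D, max N M, by positivity, fun x => ?_⟩
  have hx : 1 ≤ 1 + |x| := by simp
  calc |f x + g x| ≤ C * (1 + |x|) ^ N + D * (1 + |x|) ^ M :=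
        (abs_add_le _ _).trans (add_le_add (hf x) (hg x))
    _ ≤ C * (1 + |x|) ^ max N M + D * (1 + |x|) ^ max N M := by
        gcongr <;> first | exact hx | simp
    _ = (C + D) * (1 + |x|) ^ max N M := by ring

theorem pow (hf : PolyGrowth f) (n : ℕ) : PolyGrowth fun x => f x ^ n := by
  induction n with
  | zero => simpa using const 1
  | succ n ih => simpa [pow_succ] using ih.mul hf

theorem abs (hf : PolyGrowth f) : PolyGrowth fun x => |f x| :=
  hf.mono fun x => (abs_abs (f x)).le

theorem sum {ι : Type*} (s : Finset ι) {f : ι → ℝ → ℝ} (hf : ∀ i ∈ s, PolyGrowth (f i)) :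
    PolyGrowth fun x => ∑ i ∈ s, f i x := by
  classical
  induction s using Finset.induction_on with
  | empty => simpa using const 0
  | insert i s hi ih =>
    simp only [Finset.sum_insert hi]
    exact (hf i (Finset.mem_insert_self i s)).add
      (ih fun j hj => hf j (Finset.mem_insert_of_mem hj))

theorem eval (p : Polynomial ℝ) : PolyGrowth fun x => p.eval x := by
  simp only [Polynomial.eval_eq_sum_range]
  exact sum _ fun i _ => (const (p.coeff i)).mul (id.pow i)

end PolyGrowth

section GaussianIntegral

variable {f : ℝ → ℝ} {μ : ℝ} {v : ℝ≥0}

theorem integrable_one_add_abs_pow_gaussianReal (N : ℕ) :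
    Integrable (fun x : ℝ => (1 + |x|) ^ N) (gaussianReal μ v) := by
  have h : MemLp (fun x : ℝ => 1 + |x|) N (gaussianReal μ v) :=
    (memLp_const (1 : ℝ)).add (memLp_id_gaussianReal (N : ℝ≥0)).abs
  refine h.integrable_norm_pow'.congr (ae_of_all _ fun x => ?_)
  simp only [Real.norm_of_nonneg (add_nonneg zero_le_one (abs_nonneg x))]

theorem PolyGrowth.integrable (hf : PolyGrowth f) (hm : Measurable f) :
    Integrable f (gaussianReal μ v) := by
  obtain ⟨C, N, -, hf⟩ := hf
  exact ((integrable_one_add_abs_pow_gaussianReal N).const_mul C).mono'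
    hm.aestronglyMeasurable (ae_of_all _ hf)

theorem PolyGrowth.memLp_two (hf : PolyGrowth f) (hm : Measurable f) :
    MemLp f 2 (gaussianReal μ v) :=
  (memLp_two_iff_integrable_sq hm.aestronglyMeasurable).2
    ((hf.pow 2).integrable (hm.pow_const 2))

theorem integrable_eval_gaussianReal (p : Polynomial ℝ) :
    Integrable (fun x => p.eval x) (gaussianReal μ v) :=
  (PolyGrowth.eval p).integrable p.continuous.measurable

theorem integrable_gaussianReal_iff (hv : v ≠ 0) :
    Integrable f (gaussianReal μ v) ↔ Integrable fun x => f x * gaussianPDFReal μ v x := by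
  rw [gaussianReal_of_var_ne_zero _ hv,
    integrable_withDensity_iff_integrable_smul' (measurable_gaussianPDF μ v)
      (ae_of_all _ fun x => gaussianPDF_lt_top)]
  simp only [toReal_gaussianPDF, smul_eq_mul, mul_comm]

theorem integral_gaussianReal_eq_integral_mul (hv : v ≠ 0) (f : ℝ → ℝ) :
    ∫ x, f x ∂(gaussianReal μ v) = ∫ x, f x * gaussianPDFReal μ v x := by
  simp only [integral_gaussianReal_eq_integral_smul hv, smul_eq_mul, mul_comm]

theorem contDiff_gaussianPDFReal {n : WithTop ℕ∞} : ContDiff ℝ n (gaussianPDFReal μ v) := by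
  unfold gaussianPDFReal
  fun_prop

theorem hasDerivAt_gaussianPDFReal (x : ℝ) :
    HasDerivAt (gaussianPDFReal μ v) (-((x - μ) / v) * gaussianPDFReal μ v x) x := by
  have h : HasDerivAt (fun x : ℝ => -(x - μ) ^ 2 / (2 * v)) (-((x - μ) / v)) x := by
    convert! ((((hasDerivAt_id x).sub_const μ).pow 2).neg).div_const (2 * (v : ℝ)) using 1
    simp only [id_eq]
    ring
  convert! h.exp.const_mul (√(2 * Real.pi * v))⁻¹ using 1
  rw [gaussianPDFReal]
  ring

end GaussianIntegral

section LocallyLipschitz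

open Filter Set Topology

/-- `f` is locally Lipschitz on `J`, with Lipschitz constants of polynomial growth. -/
def LipPolyOn (f : ℝ → ℝ) (J : Set ℝ) : Prop :=
  ∃ C : ℝ, ∃ N : ℕ, 0 ≤ C ∧ ∀ x ∈ J, ∀ y ∈ J, |f x - f y| ≤ C * |x - y| * (1 + |x| + |y|) ^ N

namespace LipPolyOn

variable {f g G : ℝ → ℝ} {J : Set ℝ}

theorem polyGrowth (hf : LipPolyOn f univ) : PolyGrowth f := by
  obtain ⟨C, N, hC, hf⟩ := hf
  refine ⟨|f 0| + C, N + 1, by positivity, fun x => ?_⟩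
  have hx : 1 ≤ (1 + |x|) ^ (N + 1) := one_le_pow₀ (by simp)
  calc |f x| ≤ |f 0| + |f x - f 0| := by simpa using abs_add_le (f 0) (f x - f 0)
    _ ≤ |f 0| + C * |x| * (1 + |x|) ^ N := by simpa using hf x (mem_univ x) 0 (mem_univ 0)
    _ ≤ |f 0| * (1 + |x|) ^ (N + 1) + C * (1 + |x|) * (1 + |x|) ^ N := by
      gcongr
      · exact le_mul_of_one_le_right (abs_nonneg _) hx
      · simp
    _ = (|f 0| + C) * (1 + |x|) ^ (N + 1) := by ring

theorem absolutelyContinuousOnInterval (hf : LipPolyOn f univ) (a b : ℝ) :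
    AbsolutelyContinuousOnInterval f a b := by
  obtain ⟨C, N, hC, hf⟩ := hf
  let M := max |a| |b|
  have : 0 ≤ M := (abs_nonneg a).trans (le_max_left _ _)
  have hlip : LipschitzOnWith (C * (1 + M + M) ^ N).toNNReal f (uIcc a b) := by
    refine LipschitzOnWith.of_dist_le_mul fun x hx y hy => ?_
    have hxM : |x| ≤ M := abs_le_max_abs_abs hx.1 hx.2 |>.trans (by grind)
    have hyM : |y| ≤ M := abs_le_max_abs_abs hy.1 hy.2 |>.trans (by grind)
    rw [Real.coe_toNNReal _ (by positivity), Real.dist_eq, Real.dist_eq]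
    calc |f x - f y| ≤ C * |x - y| * (1 + |x| + |y|) ^ N := hf x (mem_univ x) y (mem_univ y)
      _ ≤ C * |x - y| * (1 + M + M) ^ N := by gcongr
      _ = C * (1 + M + M) ^ N * |x - y| := by ring
  exact hlip.absolutelyContinuousOnInterval

theorem continuous (hf : LipPolyOn f univ) : Continuous f :=
  continuous_iff_continuousAt.2 fun x =>
    (hf.absolutelyContinuousOnInterval (x - 1) (x + 1)).continuousOn.continuousAt
      (by rw [uIcc_of_le (by linarith)]; exact Icc_mem_nhds (by linarith) (by linarith))

theorem polyGrowth_deriv (hf : LipPolyOn f univ) : PolyGrowth (deriv f) := by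
  obtain ⟨C, N, hC, hf⟩ := hf
  refine ⟨C * 2 ^ N, N, by positivity, fun x => ?_⟩
  refine norm_deriv_le_of_lip' (𝕜 := ℝ) (f := f) (by positivity) ?_
  have hnear : ∀ᶠ y in 𝓝 x, |y| < 1 + |x| :=
    continuous_abs.continuousAt.eventually_lt_const (by simp)
  filter_upwards [hnear] with y hy
  calc |f y - f x| ≤ C * |y - x| * (1 + |y| + |x|) ^ N := hf y (mem_univ y) x (mem_univ x)
    _ ≤ C * |y - x| * (2 * (1 + |x|)) ^ N := by gcongr; linarith
    _ = C * 2 ^ N * (1 + |x|) ^ N * |y - x| := by rw [mul_pow]; ring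

/-- The exceptional set `s` may contain corners of `f`, across which continuity alone suffices. -/
theorem of_abs_deriv_le (hJ : J.OrdConnected) (hf : ContinuousOn f J) {s : Set ℝ}
    (hs : s.Countable) (hd : ∀ x ∈ J \ s, DifferentiableAt ℝ f x) {b : ℝ → ℝ}
    (hb : PolyGrowth b) (hfb : ∀ x ∈ J \ s, |deriv f x| ≤ b x) : LipPolyOn f J := by
  obtain ⟨C, N, hC, hb⟩ := hb
  refine ⟨C, N, hC, fun x hx y hy => ?_⟩
  have hsub : uIcc y x ⊆ J := hJ.uIcc_subset hy hx
  have hbound : ∀ᵐ t, t ∈ uIoc y x → ‖deriv f t‖ ≤ C * (1 + |x| + |y|) ^ N := by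
    filter_upwards [hs.ae_notMem volume] with t hts ht
    have htyx : t ∈ uIcc y x := uIoc_subset_uIcc ht
    have habs : |t| ≤ |x| + |y| := by
      have := abs_le_max_abs_abs htyx.1 htyx.2
      grind
    calc |deriv f t| ≤ C * (1 + |t|) ^ N :=
          (hfb t ⟨hsub htyx, hts⟩).trans ((le_abs_self _).trans (hb t))
      _ ≤ C * (1 + |x| + |y|) ^ N := by rw [add_assoc]; gcongr
  have hint : IntervalIntegrable (deriv f) volume y x := by
    refine (intervalIntegrable_const (c := C * (1 + |x| + |y|) ^ N)).mono_fun'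
      (measurable_deriv f).aestronglyMeasurable ?_
    rwa [EventuallyLE, ae_restrict_iff' measurableSet_uIoc]
  have hftc : ∫ t in y..x, deriv f t = f x - f y :=
    integral_eq_of_hasDerivAt_off_countable f (deriv f) hs (hf.mono hsub)
      (fun t ht => (hd t ⟨hsub (Ioo_subset_Icc_self ht.1), ht.2⟩).hasDerivAt) hint
  rw [← hftc, mul_right_comm]
  exact intervalIntegral.norm_integral_le_of_norm_le_const_ae hbound

theorem add (hf : LipPolyOn f J) (hg : LipPolyOn g J) : LipPolyOn (fun x => f x + g x) J := by
  obtain ⟨C, N, hC, hf⟩ := hf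
  obtain ⟨D, M, hD, hg⟩ := hg
  refine ⟨C + D, max N M, by positivity, fun x hx y hy => ?_⟩
  have hxy : 1 ≤ 1 + |x| + |y| := by have := abs_nonneg x; have := abs_nonneg y; linarith
  calc |f x + g x - (f y + g y)| = |(f x - f y) + (g x - g y)| := by ring_nf
    _ ≤ C * |x - y| * (1 + |x| + |y|) ^ N + D * |x - y| * (1 + |x| + |y|) ^ M :=
      (abs_add_le _ _).trans (add_le_add (hf x hx y hy) (hg x hx y hy))
    _ ≤ C * |x - y| * (1 + |x| + |y|) ^ max N M + D * |x - y| * (1 + |x| + |y|) ^ max N M := by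
      gcongr <;> first | exact hxy | simp
    _ = (C + D) * |x - y| * (1 + |x| + |y|) ^ max N M := by ring

theorem mul (hf : LipPolyOn f univ) (hg : LipPolyOn g univ) :
    LipPolyOn (fun x => f x * g x) univ := by
  obtain ⟨A, P, hA, hfA⟩ := hf.polyGrowth
  obtain ⟨B, Q, hB, hgB⟩ := hg.polyGrowth
  obtain ⟨C, N, hC, hf⟩ := hf
  obtain ⟨D, M, hD, hg⟩ := hg
  refine ⟨C * B + A * D, max (N + Q) (P + M), by positivity, fun x hx y hy => ?_⟩
  set t := 1 + |x| + |y| with ht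
  have hxt : 1 + |x| ≤ t := by simp [ht]
  have hyt : 1 + |y| ≤ t := by simp [ht]
  have ht1 : 1 ≤ t := le_trans (by simp) hxt
  calc |f x * g x - f y * g y| = |(f x - f y) * g x + f y * (g x - g y)| := by ring_nf
    _ ≤ |f x - f y| * |g x| + |f y| * |g x - g y| := by
      rw [← abs_mul, ← abs_mul]; exact abs_add_le _ _
    _ ≤ (C * |x - y| * t ^ N) * (B * t ^ Q) + (A * t ^ P) * (D * |x - y| * t ^ M) := by
      gcongr
      · exact hf x hx y hy
      · exact (hgB x).trans (by gcongr)
      · exact (hfA y).trans (by gcongr)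
      · exact hg x hx y hy
    _ = C * B * |x - y| * t ^ (N + Q) + A * D * |x - y| * t ^ (P + M) := by ring
    _ ≤ C * B * |x - y| * t ^ max (N + Q) (P + M) +
        A * D * |x - y| * t ^ max (N + Q) (P + M) := by
      gcongr <;> first | exact ht1 | simp
    _ = (C * B + A * D) * |x - y| * t ^ max (N + Q) (P + M) := by ring

theorem comp (hf : LipPolyOn f J) (hG : LipPolyOn G univ) (hGJ : ∀ x, G x ∈ J) :
    LipPolyOn (fun x => f (G x)) univ := by
  obtain ⟨A, P, hA, hGA⟩ := hG.polyGrowth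
  obtain ⟨C, N, hC, hf⟩ := hf
  obtain ⟨D, M, hD, hG⟩ := hG
  refine ⟨C * D * (1 + A + A) ^ N, M + P * N, by positivity, fun x hx y hy => ?_⟩
  set t := 1 + |x| + |y| with ht
  have hxt : 1 + |x| ≤ t := by simp [ht]
  have hyt : 1 + |y| ≤ t := by simp [ht]
  have ht1 : 1 ≤ t ^ P := one_le_pow₀ (le_trans (by simp) hxt)
  have hGx : |G x| ≤ A * t ^ P := (hGA x).trans (by gcongr)
  have hGy : |G y| ≤ A * t ^ P := (hGA y).trans (by gcongr)
  calc |f (G x) - f (G y)| ≤ C * |G x - G y| * (1 + |G x| + |G y|) ^ N :=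
        hf _ (hGJ x) _ (hGJ y)
    _ ≤ C * (D * |x - y| * t ^ M) * (t ^ P + A * t ^ P + A * t ^ P) ^ N := by
      gcongr
      exact hG x hx y hy
    _ = C * D * (1 + A + A) ^ N * |x - y| * t ^ (M + P * N) := by
      rw [← one_add_mul, ← add_mul, mul_pow, pow_add, pow_mul]; ring

end LipPolyOn

theorem lipPolyOn_eval (p : Polynomial ℝ) : LipPolyOn (fun x => p.eval x) univ := by
  refine .of_abs_deriv_le ordConnected_univ p.continuousOn countable_empty
    (fun x _ => p.differentiableAt) (PolyGrowth.eval p.derivative).abs fun x _ => ?_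
  rw [p.deriv]

end LocallyLipschitz

section Tempered

open Filter Polynomial Set Topology

/-- `f` and its derivatives of orders `1, …, m` exist on `J` and are locally Lipschitz there, with
Lipschitz constants of polynomial growth. -/
def TemperedOn : ℕ → (ℝ → ℝ) → Set ℝ → Prop
  | 0, f, J => LipPolyOn f J
  | m + 1, f, J =>
    LipPolyOn f J ∧ ∃ f' : ℝ → ℝ, (∀ x ∈ J, HasDerivAt f (f' x) x) ∧ TemperedOn m f' J

namespace TemperedOn

variable {m k : ℕ} {f g G : ℝ → ℝ} {J : Set ℝ}

theorem lipPolyOn (hf : TemperedOn m f J) : LipPolyOn f J := by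
  cases m with
  | zero => exact hf
  | succ m => exact hf.1

theorem of_succ (hf : TemperedOn (m + 1) f J) : TemperedOn m f J := by
  induction m generalizing f with
  | zero => exact hf.1
  | succ m ih =>
    obtain ⟨hl, f', hd, hf'⟩ := hf
    exact ⟨hl, f', hd, ih hf'⟩

theorem of_le (hf : TemperedOn m f J) (hk : k ≤ m) : TemperedOn k f J := by
  induction m, hk using Nat.le_induction with
  | base => exact hf
  | succ m _ ih => exact ih hf.of_succ

theorem add (hf : TemperedOn m f J) (hg : TemperedOn m g J) :
    TemperedOn m (fun x => f x + g x) J := by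
  induction m generalizing f g with
  | zero => exact LipPolyOn.add hf hg
  | succ m ih =>
    obtain ⟨hfl, f', hfd, hf'⟩ := hf
    obtain ⟨hgl, g', hgd, hg'⟩ := hg
    exact ⟨hfl.add hgl, _, fun x hx => (hfd x hx).add (hgd x hx), ih hf' hg'⟩

theorem mul (hf : TemperedOn m f univ) (hg : TemperedOn m g univ) :
    TemperedOn m (fun x => f x * g x) univ := by
  induction m generalizing f g with
  | zero => exact LipPolyOn.mul hf hg
  | succ m ih =>
    have hfm := hf.of_succ
    have hgm := hg.of_succ
    obtain ⟨hfl, f', hfd, hf'⟩ := hf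
    obtain ⟨hgl, g', hgd, hg'⟩ := hg
    exact ⟨hfl.mul hgl, _, fun x hx => (hfd x hx).mul (hgd x hx), (ih hf' hgm).add (ih hfm hg')⟩

theorem comp (hf : TemperedOn m f J) (hG : TemperedOn m G univ) (hGJ : ∀ x, G x ∈ J) :
    TemperedOn m (fun x => f (G x)) univ := by
  induction m generalizing f with
  | zero => exact LipPolyOn.comp hf hG hGJ
  | succ m ih =>
    have hGm := hG.of_succ
    obtain ⟨hfl, f', hfd, hf'⟩ := hf
    obtain ⟨hGl, G', hGd, hG'⟩ := hG
    exact ⟨hfl.comp hGl hGJ, _, fun x hx => (hfd (G x) (hGJ x)).comp x (hGd x hx),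
      (ih hf' hGm).mul hG'⟩

end TemperedOn

theorem temperedOn_eval (m : ℕ) (p : ℝ[X]) : TemperedOn m (fun x => p.eval x) univ := by
  induction m generalizing p with
  | zero => exact lipPolyOn_eval p
  | succ m ih =>
    exact ⟨lipPolyOn_eval p, _, fun x _ => p.hasDerivAt x, ih (derivative p)⟩

/-- Off finitely many points, `f` agrees near each point of `J` with one of finitely many
polynomials. Unlike `IsPiecewisePolynomialOn`, this local form visibly passes to derivatives. -/
def EventuallyEqPolynomialOn (f : ℝ → ℝ) (J : Set ℝ) : Prop :=
  ∃ (knots : Finset ℝ) (pieces : Finset ℝ[X]), ∀ x ∈ J, x ∉ knots →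
    ∃ p ∈ pieces, f =ᶠ[𝓝 x] fun y => p.eval y

variable {m : ℕ} {f : ℝ → ℝ} {J : Set ℝ}

/-- The pieces are indexed by the set of knots to the left of them. -/
theorem IsPiecewisePolynomialOn.eventuallyEqPolynomialOn (hf : IsPiecewisePolynomialOn f J)
    (hJ : J.OrdConnected) (hJo : IsOpen J) : EventuallyEqPolynomialOn f J := by
  classical
  obtain ⟨K, hf⟩ := hf
  let piece (S : Finset ℝ) : Set ℝ := {x ∈ J | x ∉ K ∧ {k ∈ K | k < x} = S}
  have hpiece (S : Finset ℝ) : ∃ p : ℝ[X], ∀ x ∈ piece S, f x = p.eval x := by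
    refine hf (piece S) ⟨?_⟩ (fun x hx => hx.1) (disjoint_left.2 fun x hx => hx.2.1)
    rintro x ⟨hxJ, -, hxS⟩ y ⟨hyJ, hyK, hyS⟩ z ⟨hxz, hzy⟩
    simp only [Finset.ext_iff, Finset.mem_filter] at hxS hyS
    refine ⟨hJ.out hxJ hyJ ⟨hxz, hzy⟩, ?_, ?_⟩
    · grind
    · ext k
      grind
  choose p hp using hpiece
  refine ⟨K, K.powerset.image p, fun x hxJ hxK => ?_⟩
  refine ⟨p {k ∈ K | k < x}, Finset.mem_image_of_mem p (by simp), ?_⟩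
  have hknots : ∀ᶠ y in 𝓝 x, ∀ k ∈ K, (k < x → k < y) ∧ (x < k → y < k) := by
    refine (Filter.eventually_all_finset K).2 fun k _ => ?_
    refine .and (eventually_imp_distrib_left.2 fun h => ?_)
      (eventually_imp_distrib_left.2 fun h => ?_)
    · exact eventually_gt_nhds h
    · exact eventually_lt_nhds h
  filter_upwards [hJo.mem_nhds hxJ, hknots] with y hyJ hy
  refine hp _ y ⟨hyJ, ?_, ?_⟩
  · grind
  · ext k
    grind

theorem EventuallyEqPolynomialOn.deriv (hf : EventuallyEqPolynomialOn f J) :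
    EventuallyEqPolynomialOn (deriv f) J := by
  classical
  obtain ⟨K, P, hf⟩ := hf
  refine ⟨K, P.image derivative, fun x hxJ hxK => ?_⟩
  obtain ⟨p, hp, hfp⟩ := hf x hxJ hxK
  refine ⟨derivative p, Finset.mem_image_of_mem _ hp, ?_⟩
  filter_upwards [hfp.deriv] with y hy
  rw [hy, p.deriv]

theorem EventuallyEqPolynomialOn.lipPolyOn (hf : EventuallyEqPolynomialOn f J)
    (hJ : J.OrdConnected) (hc : ContinuousOn f J) : LipPolyOn f J := by
  obtain ⟨K, P, hf⟩ := hf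
  refine .of_abs_deriv_le (b := fun x => ∑ p ∈ P, |(derivative p).eval x|) hJ hc K.countable_toSet
    (fun x hx => ?_) (.sum _ fun p _ => (PolyGrowth.eval _).abs) fun x hx => ?_
  · obtain ⟨p, -, hfp⟩ := hf x hx.1 hx.2
    exact p.differentiableAt.congr_of_eventuallyEq hfp
  · obtain ⟨p, hp, hfp⟩ := hf x hx.1 hx.2
    rw [hfp.deriv_eq, p.deriv]
    exact Finset.single_le_sum (f := fun p => |(derivative p).eval x|)
      (fun q _ => abs_nonneg _) hp

theorem EventuallyEqPolynomialOn.temperedOn (hf : EventuallyEqPolynomialOn f J)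
    (hJ : J.OrdConnected) (hJo : IsOpen J) (hc : ContDiffOn ℝ m f J) : TemperedOn m f J := by
  induction m generalizing f with
  | zero => exact hf.lipPolyOn hJ hc.continuousOn
  | succ m ih =>
    have hl := hf.lipPolyOn hJ hc.continuousOn
    push_cast at hc
    rw [contDiffOn_succ_iff_deriv_of_isOpen hJo] at hc
    exact ⟨hl, _, fun x hx => (hc.1.differentiableAt (hJo.mem_nhds hx)).hasDerivAt,
      ih hf.deriv hc.2.2⟩

theorem IsSplineOn.temperedOn (hf : IsSplineOn m f J) (hJ : J.OrdConnected) (hJo : IsOpen J) :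
    TemperedOn m f J :=
  (hf.2.eventuallyEqPolynomialOn hJ hJo).temperedOn hJ hJo hf.1

end Tempered

section Stein

open Filter Set Topology

variable {f : ℝ → ℝ} {μ : ℝ} {v : ℝ≥0}

theorem integral_deriv_eq_zero_of_absolutelyContinuous
    (hac : ∀ a b, AbsolutelyContinuousOnInterval f a b) (hf : Integrable f)
    (hf' : Integrable (deriv f)) : ∫ x, deriv f x = 0 := by
  have hftc (b : ℝ) : ∫ x in (0)..b, deriv f x = f b - f 0 := (hac 0 b).integral_deriv_eq_sub
  have hftc' (a : ℝ) : ∫ x in a..0, deriv f x = f 0 - f a := (hac a 0).integral_deriv_eq_sub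
  have hright := intervalIntegral_tendsto_integral_Ioi 0 hf'.integrableOn tendsto_id
  have hleft := intervalIntegral_tendsto_integral_Iic 0 hf'.integrableOn tendsto_id
  simp only [hftc, hftc', id_eq] at hright hleft
  have htop : f 0 + ∫ x in Ioi 0, deriv f x = 0 := by
    refine IntegrableAtFilter.eq_zero_of_tendsto (hf.integrableAtFilter atTop) (fun s hs => ?_)
      ((hright.const_add (f 0)).congr fun b => by ring)
    obtain ⟨b, hb⟩ := mem_atTop_sets.1 hs
    exact measure_mono_top hb Real.volume_Ici
  have hbot : f 0 - ∫ x in Iic 0, deriv f x = 0 := by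
    refine IntegrableAtFilter.eq_zero_of_tendsto (hf.integrableAtFilter atBot) (fun s hs => ?_)
      ((hleft.const_sub (f 0)).congr fun a => by ring)
    obtain ⟨a, ha⟩ := mem_atBot_sets.1 hs
    exact measure_mono_top ha Real.volume_Iic
  rw [← intervalIntegral.integral_Iic_add_Ioi hf'.integrableOn hf'.integrableOn]
  linarith

theorem LipPolyOn.ae_differentiableAt (hf : LipPolyOn f univ) :
    ∀ᵐ x, DifferentiableAt ℝ f x := by
  have h : ∀ᵐ x, ∀ n : ℕ, x ∈ uIcc (-n : ℝ) n → DifferentiableAt ℝ f x :=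
    ae_all_iff.2 fun n => (hf.absolutelyContinuousOnInterval (-n) n).ae_differentiableAt
  filter_upwards [h] with x hx
  obtain ⟨n, hn⟩ := exists_nat_ge |x|
  exact hx n (Icc_subset_uIcc (abs_le.1 hn))

theorem LipPolyOn.ae_differentiableAt_gaussianReal (hf : LipPolyOn f univ) (hv : v ≠ 0) :
    ∀ᵐ x ∂(gaussianReal μ v), DifferentiableAt ℝ f x :=
  (gaussianReal_absolutelyContinuous μ hv).ae_le hf.ae_differentiableAt

theorem LipPolyOn.integrable_deriv (hf : LipPolyOn f univ) :
    Integrable (deriv f) (gaussianReal μ v) :=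
  hf.polyGrowth_deriv.integrable (measurable_deriv f)

theorem LipPolyOn.integrable (hf : LipPolyOn f univ) : Integrable f (gaussianReal μ v) :=
  hf.polyGrowth.integrable hf.continuous.measurable

/-- The boundary terms vanish in the integration by parts of `f * ρ`, where `ρ' = -(x - μ) / v * ρ`
for the Gaussian density `ρ`. -/
theorem LipPolyOn.integral_sub_mul_gaussianReal (hf : LipPolyOn f univ) (hv : v ≠ 0) :
    ∫ x, (x - μ) * f x ∂(gaussianReal μ v) = v * ∫ x, deriv f x ∂(gaussianReal μ v) := by
  have hv' : (v : ℝ) ≠ 0 := by exact_mod_cast hv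
  have hxf : Integrable (fun x => (x - μ) / v * f x) (gaussianReal μ v) := by
    have h : PolyGrowth fun x => (x - μ) / v := by
      simpa [sub_eq_add_neg, div_eq_mul_inv] using (PolyGrowth.id.add (.const (-μ))).mul (.const _)
    exact (h.mul hf.polyGrowth).integrable
      (((measurable_id.sub_const μ).div_const _).mul hf.continuous.measurable)
  have hd : deriv (fun x => f x * gaussianPDFReal μ v x) =ᵐ[volume]
      fun x => (deriv f x - (x - μ) / v * f x) * gaussianPDFReal μ v x := by
    filter_upwards [hf.ae_differentiableAt] with x hx
    rw [(hx.hasDerivAt.fun_mul (hasDerivAt_gaussianPDFReal x)).deriv]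
    ring
  have hzero : ∫ x, (deriv f x - (x - μ) / v * f x) ∂(gaussianReal μ v) = 0 := by
    rw [integral_gaussianReal_eq_integral_mul hv, ← integral_congr_ae hd]
    refine integral_deriv_eq_zero_of_absolutelyContinuous (fun a b => ?_)
      ((integrable_gaussianReal_iff hv).1 hf.integrable)
      (((integrable_gaussianReal_iff hv).1 (hf.integrable_deriv.sub hxf)).congr hd.symm)
    exact (hf.absolutelyContinuousOnInterval a b).fun_mul
      contDiff_gaussianPDFReal.contDiffOn.absolutelyContinuousOnInterval
  rw [integral_sub hf.integrable_deriv hxf, sub_eq_zero] at hzero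
  rw [hzero, ← integral_const_mul]
  congr 1 with x
  field_simp

end Stein

/-- The probabilists' Hermite polynomials with real coefficients. -/
noncomputable def hermiteR (n : ℕ) : Polynomial ℝ :=
  (Polynomial.hermite n).map (Int.castRingHom ℝ)

local notation "γ" => gaussianReal 0 1

section Hermite

open Polynomial Set

theorem hermiteR_zero : hermiteR 0 = 1 := by simp [hermiteR]

theorem hermiteR_one : hermiteR 1 = X := by simp [hermiteR]

theorem hermiteR_succ (n : ℕ) : hermiteR (n + 1) = X * hermiteR n - derivative (hermiteR n) := by
  simp [hermiteR, hermite_succ, derivative_map]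

theorem monic_hermiteR (n : ℕ) : (hermiteR n).Monic := (hermite_monic n).map _

theorem natDegree_hermiteR (n : ℕ) : (hermiteR n).natDegree = n := by
  rw [hermiteR, (hermite_monic n).natDegree_map, natDegree_hermite]

theorem derivative_hermiteR_succ (n : ℕ) :
    derivative (hermiteR (n + 1)) = C ((n : ℝ) + 1) * hermiteR n := by
  induction n with
  | zero => simp [hermiteR_one, hermiteR_zero]
  | succ n ih =>
    rw [hermiteR_succ (n + 1), derivative_sub, derivative_mul, ih, derivative_C_mul,
      hermiteR_succ n, derivative_X, Nat.cast_succ, C_add (a := (n : ℝ) + 1), C_1]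
    ring

theorem hermiteR_succ_succ (n : ℕ) :
    hermiteR (n + 2) = X * hermiteR (n + 1) - C ((n : ℝ) + 1) * hermiteR n := by
  rw [hermiteR_succ (n + 1), derivative_hermiteR_succ]

/-- For `n = 0` the truncated index `n - 1` is immaterial: its coefficient vanishes. -/
theorem X_mul_hermiteR (n : ℕ) :
    X * hermiteR n = hermiteR (n + 1) + C (n : ℝ) * hermiteR (n - 1) := by
  cases n with
  | zero => simp [hermiteR_zero, hermiteR_one]
  | succ n => rw [hermiteR_succ_succ]; simp

theorem LipPolyOn.integral_mul_hermiteR_succ {f : ℝ → ℝ} (hf : LipPolyOn f univ) (n : ℕ) :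
    ∫ x, f x * (hermiteR (n + 1)).eval x ∂γ = ∫ x, deriv f x * (hermiteR n).eval x ∂γ := by
  have hH := lipPolyOn_eval (hermiteR n)
  have hstein := (hf.mul hH).integral_sub_mul_gaussianReal (μ := 0) one_ne_zero
  have hd : deriv (fun x => f x * (hermiteR n).eval x) =ᵐ[γ]
      fun x => deriv f x * (hermiteR n).eval x + f x * (derivative (hermiteR n)).eval x := by
    filter_upwards [hf.ae_differentiableAt_gaussianReal one_ne_zero] with x hx
    exact (hx.hasDerivAt.mul ((hermiteR n).hasDerivAt x)).deriv
  have hf'H : Integrable (fun x => deriv f x * (hermiteR n).eval x) γ :=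
    (hf.polyGrowth_deriv.mul hH.polyGrowth).integrable
      ((measurable_deriv f).mul hH.continuous.measurable)
  have hfH' : Integrable (fun x => f x * (derivative (hermiteR n)).eval x) γ :=
    (hf.mul (lipPolyOn_eval _)).integrable
  have hxfH : Integrable (fun x => x * (f x * (hermiteR n).eval x)) γ := by
    simpa using ((lipPolyOn_eval X).mul (hf.mul hH)).integrable (μ := 0) (v := 1)
  simp only [sub_zero, NNReal.coe_one, one_mul] at hstein
  rw [integral_congr_ae hd, integral_add hf'H hfH', ← sub_eq_iff_eq_add,
    ← integral_sub hxfH hfH'] at hstein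
  rw [← hstein]
  congr 1 with x
  rw [hermiteR_succ, eval_sub, eval_mul, eval_X]
  ring

theorem integral_eval_mul_hermiteR (p : ℝ[X]) (n : ℕ) :
    ∫ x, p.eval x * (hermiteR n).eval x ∂γ = ∫ x, (derivative^[n] p).eval x ∂γ := by
  induction n generalizing p with
  | zero => simp [hermiteR_zero]
  | succ n ih =>
    rw [(lipPolyOn_eval p).integral_mul_hermiteR_succ, Function.iterate_succ_apply, ← ih]
    simp only [Polynomial.deriv]

theorem integral_eval_mul_hermiteR_of_natDegree_lt {p : ℝ[X]} {n : ℕ} (h : p.natDegree < n) :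
    ∫ x, p.eval x * (hermiteR n).eval x ∂γ = 0 := by
  rw [integral_eval_mul_hermiteR, iterate_derivative_eq_zero h]
  simp

theorem iterate_derivative_hermiteR (n : ℕ) :
    derivative^[n] (hermiteR n) = C (n.factorial : ℝ) := by
  induction n with
  | zero => simp [hermiteR_zero]
  | succ n ih =>
    rw [Function.iterate_succ_apply, derivative_hermiteR_succ, iterate_derivative_C_mul, ih,
      ← C_mul, Nat.factorial_succ]
    push_cast
    rfl

theorem integral_hermiteR_sq (n : ℕ) :
    ∫ x, (hermiteR n).eval x * (hermiteR n).eval x ∂γ = n.factorial := by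
  rw [integral_eval_mul_hermiteR, iterate_derivative_hermiteR]
  simp

theorem integral_hermiteR_mul_of_ne {i j : ℕ} (h : i ≠ j) :
    ∫ x, (hermiteR i).eval x * (hermiteR j).eval x ∂γ = 0 := by
  rcases lt_or_gt_of_ne h with h | h
  · exact integral_eval_mul_hermiteR_of_natDegree_lt (by rwa [natDegree_hermiteR])
  · simp only [mul_comm ((hermiteR i).eval _)]
    exact integral_eval_mul_hermiteR_of_natDegree_lt (by rwa [natDegree_hermiteR])

end Hermite

section Quadrature

open Polynomial

theorem mem_hermiteNodes {n : ℕ} {x : ℝ} : x ∈ hermiteNodes n ↔ (hermiteR n).eval x = 0 := by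
  change x ∈ (hermiteR n).roots.toFinset ↔ _
  rw [Multiset.mem_toFinset, mem_roots (monic_hermiteR n).ne_zero, IsRoot.def]

theorem isCoprime_hermiteR_succ (n : ℕ) : IsCoprime (hermiteR (n + 1)) (hermiteR n) := by
  induction n with
  | zero => rw [hermiteR_zero]; exact isCoprime_one_right
  | succ n ih =>
    have hunit : IsUnit (C (-((n : ℝ) + 1))) :=
      isUnit_C.2 (neg_ne_zero.2 n.cast_add_one_ne_zero).isUnit
    have hrec : hermiteR (n + 2) = C (-((n : ℝ) + 1)) * hermiteR n + hermiteR (n + 1) * X := by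
      rw [hermiteR_succ_succ, C_neg]
      ring
    rw [hrec, IsCoprime.add_mul_left_left_iff, isCoprime_mul_unit_left_left hunit]
    exact ih.symm

theorem separable_hermiteR (n : ℕ) : (hermiteR n).Separable := by
  cases n with
  | zero => rw [hermiteR_zero]; exact separable_one
  | succ n =>
    rw [separable_def, derivative_hermiteR_succ,
      isCoprime_mul_unit_left_right (isUnit_C.2 n.cast_add_one_ne_zero.isUnit)]
    exact isCoprime_hermiteR_succ n

theorem integral_eval_pos {p : ℝ[X]} (hp : ∀ x, 0 ≤ p.eval x) (hp0 : p ≠ 0) :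
    0 < ∫ x, p.eval x ∂γ := by
  refine (integral_nonneg hp).lt_of_ne fun h => hp0 ?_
  have hγ : (fun x => p.eval x) =ᵐ[γ] 0 :=
    (integral_eq_zero_iff_of_nonneg hp (integrable_eval_gaussianReal p)).1 h.symm
  have hvol : (fun x => p.eval x) =ᵐ[volume] fun _ => (0 : ℝ) :=
    (gaussianReal_absolutelyContinuous' 0 one_ne_zero).ae_le hγ
  have heq := (Continuous.ae_eq_iff_eq volume p.continuous continuous_const).1 hvol
  exact Polynomial.funext fun x => by simpa using congrFun heq x

theorem exists_ne_zero_forall_mul_eval_nonneg_of_roots_eq_zero {q : ℝ[X]} (hq0 : q ≠ 0)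
    (hq : q.roots = 0) : ∃ c : ℝ, c ≠ 0 ∧ ∀ x, 0 ≤ c * q.eval x := by
  by_contra! h
  obtain ⟨a, ha⟩ := h 1 one_ne_zero
  obtain ⟨b, hb⟩ := h (-1) (neg_ne_zero.2 one_ne_zero)
  obtain ⟨c, hc⟩ := mem_range_of_exists_le_of_exists_ge (c := 0) q.continuous
    ⟨a, by linarith⟩ ⟨b, by linarith⟩
  have hroot : c ∈ q.roots := (mem_roots hq0).2 hc
  simp [hq] at hroot

/-- If `He_n` had fewer than `n` real zeros, its product with `∏ (x - a)` over them would have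
constant sign and yet Gaussian integral `0`. -/
theorem card_hermiteNodes (n : ℕ) : (hermiteNodes n).card = n := by
  change (hermiteR n).roots.toFinset.card = n
  rw [Multiset.toFinset_card_of_nodup (nodup_roots (separable_hermiteR n))]
  obtain ⟨q, hq, hdeg, hroots⟩ := exists_prod_multiset_X_sub_C_mul (hermiteR n)
  rw [natDegree_hermiteR] at hdeg
  by_contra hne
  set p := ((hermiteR n).roots.map fun a => X - C a).prod with hp
  have hpdeg : p.natDegree < n := by rw [hp, natDegree_multiset_prod_X_sub_C_eq_card]; lia
  obtain ⟨hp0, hq0⟩ : p ≠ 0 ∧ q ≠ 0 := mul_ne_zero_iff.1 (hq ▸ (monic_hermiteR n).ne_zero)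
  obtain ⟨c, hc, hcq⟩ := exists_ne_zero_forall_mul_eval_nonneg_of_roots_eq_zero hq0 hroots
  have hpos : 0 < ∫ x, (p ^ 2 * (C c * q)).eval x ∂γ := by
    refine integral_eval_pos (fun x => ?_) (by simp [hp0, hc, hq0])
    rw [eval_mul, eval_pow, eval_mul, eval_C]
    exact mul_nonneg (sq_nonneg _) (hcq x)
  have hzero : ∫ x, (p ^ 2 * (C c * q)).eval x ∂γ = 0 := by
    have heval (x : ℝ) : (p ^ 2 * (C c * q)).eval x = c * (p.eval x * (hermiteR n).eval x) := by
      rw [← hq]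
      simp only [eval_mul, eval_pow, eval_C]
      ring
    simp only [heval, integral_const_mul, integral_eval_mul_hermiteR_of_natDegree_lt hpdeg,
      mul_zero]
  exact hpos.ne' hzero

theorem gaussHermite_one (n : ℕ) (f : ℝ → ℝ) :
    gaussHermite n 1 f = ∑ x ∈ hermiteNodes n, gaussHermiteWeight n x * f x := by
  simp [gaussHermite]

theorem gaussHermite_const_mul (n : ℕ) (v : ℝ≥0) (c : ℝ) (f : ℝ → ℝ) :
    gaussHermite n v (fun x => c * f x) = c * gaussHermite n v f := by
  simp only [gaussHermite, Finset.mul_sum, mul_left_comm]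

theorem gaussHermite_add (n : ℕ) (v : ℝ≥0) (f g : ℝ → ℝ) :
    gaussHermite n v (fun x => f x + g x) = gaussHermite n v f + gaussHermite n v g := by
  simp only [gaussHermite, mul_add, Finset.sum_add_distrib]

theorem gaussHermite_sum {ι : Type*} (s : Finset ι) (n : ℕ) (v : ℝ≥0) (f : ι → ℝ → ℝ) :
    gaussHermite n v (fun x => ∑ i ∈ s, f i x) = ∑ i ∈ s, gaussHermite n v (f i) := by
  simp only [gaussHermite, Finset.mul_sum]
  exact Finset.sum_comm

theorem gaussHermite_eval_mul_hermiteR (n : ℕ) (p : ℝ[X]) :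
    gaussHermite n 1 (fun x => (p * hermiteR n).eval x) = 0 := by
  rw [gaussHermite_one]
  refine Finset.sum_eq_zero fun x hx => ?_
  rw [eval_mul, mem_hermiteNodes.1 hx, mul_zero, mul_zero]

theorem gaussHermite_eval_of_degree_lt {n : ℕ} {r : ℝ[X]} (hr : r.degree < n) :
    gaussHermite n 1 (fun x => r.eval x) = ∫ x, r.eval x ∂γ := by
  have hinterp := Lagrange.eq_interpolate (f := r) (v := id) (s := hermiteNodes n)
    Function.injective_id.injOn (by rwa [card_hermiteNodes])
  rw [gaussHermite_one]
  conv_rhs => rw [hinterp, Lagrange.interpolate_apply]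
  simp only [eval_finsetSum, eval_mul, eval_C, id]
  rw [integral_finsetSum _ fun i _ => (integrable_eval_gaussianReal _).const_mul _]
  refine Finset.sum_congr rfl fun x _ => ?_
  rw [integral_const_mul, mul_comm]
  rfl

theorem gaussHermite_eval_of_natDegree_lt {n : ℕ} {p : ℝ[X]} (hp : p.natDegree < 2 * n) :
    gaussHermite n 1 (fun x => p.eval x) = ∫ x, p.eval x ∂γ := by
  have hm := monic_hermiteR n
  have hrdeg : (p %ₘ hermiteR n).degree < n := by
    simpa [degree_eq_natDegree hm.ne_zero, natDegree_hermiteR] using degree_modByMonic_lt p hm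
  have hqdeg : (p /ₘ hermiteR n).natDegree < n := by
    rw [natDegree_divByMonic _ hm, natDegree_hermiteR]
    lia
  have hdiv : p = p %ₘ hermiteR n + p /ₘ hermiteR n * hermiteR n := by
    rw [mul_comm, modByMonic_add_div]
  have hquad : gaussHermite n 1 (fun x => p.eval x) =
      gaussHermite n 1 (fun x => (p %ₘ hermiteR n).eval x) := by
    conv_lhs => rw [hdiv]
    simp only [eval_add, gaussHermite_add, gaussHermite_eval_mul_hermiteR, add_zero]
  have hint : ∫ x, p.eval x ∂γ = ∫ x, (p %ₘ hermiteR n).eval x ∂γ := by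
    conv_lhs => rw [hdiv]
    simp only [eval_add]
    rw [integral_add (integrable_eval_gaussianReal _) (integrable_eval_gaussianReal _)]
    simp only [eval_mul, integral_eval_mul_hermiteR_of_natDegree_lt hqdeg, add_zero]
  rw [hquad, hint, gaussHermite_eval_of_degree_lt hrdeg]

/-- The weight of `x` is the integral of the square of its Lagrange polynomial. -/
theorem gaussHermiteWeight_nonneg {n : ℕ} {x : ℝ} (hx : x ∈ hermiteNodes n) :
    0 ≤ gaussHermiteWeight n x := by
  set b := Lagrange.basis (hermiteNodes n) id x with hb
  have hn : 0 < n := by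
    rw [← card_hermiteNodes n]
    exact Finset.card_pos.2 ⟨x, hx⟩
  have hdeg : (b ^ 2).natDegree < 2 * n := by
    rw [natDegree_pow, hb, Lagrange.natDegree_basis Function.injective_id.injOn hx,
      card_hermiteNodes]
    lia
  have hbx : b.eval x = 1 := Lagrange.eval_basis_self Function.injective_id.injOn hx
  have hweight : gaussHermite n 1 (fun y => (b ^ 2).eval y) = gaussHermiteWeight n x := by
    rw [gaussHermite_one, Finset.sum_eq_single_of_mem x hx fun y hy hyx => ?_]
    · rw [eval_pow, hbx, one_pow, mul_one]
    · have hby : b.eval y = 0 := Lagrange.eval_basis_of_ne (v := id) hyx.symm hy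
      simp [hby]
  rw [← hweight, gaussHermite_eval_of_natDegree_lt hdeg]
  exact integral_nonneg fun y => by rw [eval_pow]; positivity

theorem abs_gaussHermite_one_le {n : ℕ} {f g : ℝ → ℝ} (h : ∀ x ∈ hermiteNodes n, |f x| ≤ g x) :
    |gaussHermite n 1 f| ≤ gaussHermite n 1 g := by
  rw [gaussHermite_one, gaussHermite_one]
  refine (Finset.abs_sum_le_sum_abs _ _).trans (Finset.sum_le_sum fun x hx => ?_)
  rw [abs_mul, abs_of_nonneg (gaussHermiteWeight_nonneg hx)]
  exact mul_le_mul_of_nonneg_left (h x hx) (gaussHermiteWeight_nonneg hx)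

end Quadrature

section Moments

open Polynomial

theorem X_pow_succ_mul_hermiteR (k j : ℕ) : X ^ (k + 1) * hermiteR j =
    X ^ k * hermiteR (j + 1) + C (j : ℝ) * (X ^ k * hermiteR (j - 1)) := by
  rw [pow_succ, mul_assoc, X_mul_hermiteR]
  ring

theorem integral_X_pow_succ_mul_hermiteR (k j : ℕ) :
    ∫ x : ℝ, (X ^ (k + 1) * hermiteR j).eval x ∂γ =
      (∫ x, (X ^ k * hermiteR (j + 1)).eval x ∂γ) +
        (j : ℝ) * ∫ x, (X ^ k * hermiteR (j - 1)).eval x ∂γ := by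
  rw [X_pow_succ_mul_hermiteR, ← integral_const_mul,
    ← integral_add (integrable_eval_gaussianReal _) ((integrable_eval_gaussianReal _).const_mul _)]
  simp only [eval_add, eval_C_mul]

theorem integral_X_pow_mul_hermiteR_nonneg (k j : ℕ) :
    0 ≤ ∫ x, (X ^ k * hermiteR j).eval x ∂γ := by
  induction k generalizing j with
  | zero =>
    cases j with
    | zero => simp [hermiteR_zero]
    | succ j =>
      simpa using
        (integral_eval_mul_hermiteR_of_natDegree_lt (p := 1) (n := j + 1) (by simp)).ge
  | succ k ih =>
    rw [integral_X_pow_succ_mul_hermiteR]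
    exact add_nonneg (ih _) (mul_nonneg j.cast_nonneg (ih _))

/-- Multiplication by `x` acts on the `He_j` with nonnegative coefficients, so every step raises
the integral by at least as much as the quadrature, which vanishes once `j = n`. -/
theorem gaussHermite_X_pow_mul_hermiteR_le {n j : ℕ} (k : ℕ) (hj : j ≤ n) :
    gaussHermite n 1 (fun x => (X ^ k * hermiteR j).eval x) ≤
      ∫ x, (X ^ k * hermiteR j).eval x ∂γ := by
  induction k generalizing j with
  | zero =>
    rcases hj.eq_or_lt with rfl | hj
    · rw [gaussHermite_eval_mul_hermiteR]
      exact integral_X_pow_mul_hermiteR_nonneg 0 j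
    · rw [pow_zero, one_mul]
      exact (gaussHermite_eval_of_natDegree_lt (by rw [natDegree_hermiteR]; lia)).le
  | succ k ih =>
    rcases hj.eq_or_lt with rfl | hj
    · rw [gaussHermite_eval_mul_hermiteR]
      exact integral_X_pow_mul_hermiteR_nonneg _ j
    · rw [integral_X_pow_succ_mul_hermiteR, X_pow_succ_mul_hermiteR]
      simp only [eval_add, eval_C_mul, gaussHermite_add, gaussHermite_const_mul]
      exact add_le_add (ih hj) (mul_le_mul_of_nonneg_left (ih (by lia)) j.cast_nonneg)

theorem gaussHermite_pow_le (n k : ℕ) : gaussHermite n 1 (fun x => x ^ k) ≤ ∫ x, x ^ k ∂γ := by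
  simpa [hermiteR_zero] using gaussHermite_X_pow_mul_hermiteR_le k n.zero_le

theorem integrable_exp_sq_div_four : Integrable (fun x : ℝ => Real.exp (x ^ 2 / 4)) γ := by
  rw [integrable_gaussianReal_iff one_ne_zero]
  have h := (integrable_exp_neg_mul_sq (b := 1 / 4) (by norm_num)).const_mul
    (√(2 * Real.pi * ((1 : ℝ≥0) : ℝ)))⁻¹
  refine h.congr (ae_of_all _ fun x => ?_)
  simp only [gaussianPDFReal]
  rw [mul_left_comm, ← Real.exp_add, NNReal.coe_one]
  ring_nf

theorem hasSum_exp_sq_div_four (x : ℝ) :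
    HasSum (fun k : ℕ => (4 ^ k * k.factorial : ℝ)⁻¹ * x ^ (2 * k)) (Real.exp (x ^ 2 / 4)) := by
  have h := NormedSpace.expSeries_div_hasSum_exp (𝔸 := ℝ) (x ^ 2 / 4)
  rw [← Real.exp_eq_exp_ℝ] at h
  convert! h using 2 with k
  rw [div_pow, pow_mul]
  field_simp

theorem gaussHermite_exp_le (n : ℕ) :
    gaussHermite n 1 (fun x => Real.exp (x ^ 2 / 4)) ≤ ∫ x, Real.exp (x ^ 2 / 4) ∂γ := by
  set c : ℕ → ℝ := fun k => (4 ^ k * k.factorial : ℝ)⁻¹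
  have hsum : HasSum (fun k => gaussHermite n 1 (fun x => c k * x ^ (2 * k)))
      (gaussHermite n 1 (fun x => Real.exp (x ^ 2 / 4))) := by
    simp only [gaussHermite_one]
    exact hasSum_sum fun x _ => (hasSum_exp_sq_div_four x).mul_left _
  have hint (k : ℕ) : Integrable (fun x : ℝ => c k * x ^ (2 * k)) γ := by
    simpa using (integrable_eval_gaussianReal (X ^ (2 * k))).const_mul (c k)
  refine hasSum_le_of_sum_le hsum fun s => ?_
  calc ∑ k ∈ s, gaussHermite n 1 (fun x => c k * x ^ (2 * k))
      ≤ ∑ k ∈ s, ∫ x, c k * x ^ (2 * k) ∂γ := by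
        refine Finset.sum_le_sum fun k _ => ?_
        rw [gaussHermite_const_mul, integral_const_mul]
        exact mul_le_mul_of_nonneg_left (gaussHermite_pow_le n _) (by positivity)
    _ = ∫ x, ∑ k ∈ s, c k * x ^ (2 * k) ∂γ := (integral_finsetSum _ fun k _ => hint k).symm
    _ ≤ ∫ x, Real.exp (x ^ 2 / 4) ∂γ := by
        refine integral_mono (integrable_finsetSum _ fun k _ => hint k)
          integrable_exp_sq_div_four fun x => ?_
        exact sum_le_hasSum s (fun k _ => by rw [pow_mul]; positivity) (hasSum_exp_sq_div_four x)

end Moments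

section NodeBound

theorem eval_hermiteR_succ_succ (n : ℕ) (x : ℝ) : (hermiteR (n + 2)).eval x =
    x * (hermiteR (n + 1)).eval x - ((n : ℝ) + 1) * (hermiteR n).eval x := by
  rw [hermiteR_succ_succ]
  simp

theorem mul_abs_eval_hermiteR_le {s x : ℝ} (hs : 0 ≤ s) (hx : 2 * s ≤ |x|) {k : ℕ}
    (hk : k ≤ s ^ 2) : s * |(hermiteR k).eval x| ≤ |(hermiteR (k + 1)).eval x| := by
  induction k with
  | zero => simpa [hermiteR_zero, hermiteR_one] using (by linarith : s ≤ |x|)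
  | succ k ih =>
    push_cast at hk
    specialize ih (by linarith)
    rw [eval_hermiteR_succ_succ]
    calc s * |(hermiteR (k + 1)).eval x|
        = 2 * s * |(hermiteR (k + 1)).eval x| - s * |(hermiteR (k + 1)).eval x| := by ring
      _ ≤ |x| * |(hermiteR (k + 1)).eval x| - s * (s * |(hermiteR k).eval x|) := by gcongr
      _ ≤ |x| * |(hermiteR (k + 1)).eval x| - ((k : ℝ) + 1) * |(hermiteR k).eval x| := by
        rw [← mul_assoc, ← sq]; gcongr
      _ = |x * (hermiteR (k + 1)).eval x| - |((k : ℝ) + 1) * (hermiteR k).eval x| := by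
        rw [abs_mul, abs_mul, abs_of_nonneg (by positivity : (0 : ℝ) ≤ (k : ℝ) + 1)]
      _ ≤ |x * (hermiteR (k + 1)).eval x - ((k : ℝ) + 1) * (hermiteR k).eval x| :=
        abs_sub_abs_le_abs_sub _ _

theorem pow_le_abs_eval_hermiteR {s x : ℝ} (hs : 0 ≤ s) (hx : 2 * s ≤ |x|) {k : ℕ}
    (hk : k ≤ s ^ 2) : s ^ k ≤ |(hermiteR k).eval x| := by
  induction k with
  | zero => simp [hermiteR_zero]
  | succ k ih =>
    push_cast at hk
    have hk' : k ≤ s ^ 2 := by linarith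
    calc s ^ (k + 1) = s * s ^ k := pow_succ' s k
      _ ≤ s * |(hermiteR k).eval x| := by gcongr; exact ih hk'
      _ ≤ |(hermiteR (k + 1)).eval x| := mul_abs_eval_hermiteR_le hs hx hk'

theorem sq_lt_of_mem_hermiteNodes {n : ℕ} {x : ℝ} (hx : x ∈ hermiteNodes n) :
    x ^ 2 < 4 * n := by
  by_contra! h
  have hsx : 2 * √(n : ℝ) ≤ |x| := by
    refine Real.le_sqrt_of_sq_le (y := x ^ 2) ?_ |>.trans_eq (Real.sqrt_sq_eq_abs x)
    rwa [mul_pow, Real.sq_sqrt n.cast_nonneg, show (2 : ℝ) ^ 2 = 4 by norm_num]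
  have hle := pow_le_abs_eval_hermiteR (Real.sqrt_nonneg _) hsx (Real.sq_sqrt n.cast_nonneg).ge
  rw [mem_hermiteNodes.1 hx, abs_zero] at hle
  refine hle.not_gt ?_
  cases n with
  | zero => simp
  | succ n => positivity

end NodeBound

section Cramer

open Polynomial

theorem derivative_derivative_hermiteR (n : ℕ) : derivative (derivative (hermiteR n)) =
    X * derivative (hermiteR n) - C (n : ℝ) * hermiteR n := by
  have h := derivative_hermiteR_succ n
  rw [hermiteR_succ, derivative_sub, derivative_mul, derivative_X, one_mul, C_add, C_1] at h
  linear_combination -h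

theorem eval_zero_hermiteR_sq_le (n : ℕ) : (hermiteR n).eval 0 ^ 2 ≤ n.factorial := by
  induction n using Nat.twoStepInduction with
  | zero => simp [hermiteR_zero]
  | one => simp [hermiteR_one]
  | more n ih _ =>
    rw [eval_hermiteR_succ_succ, Nat.factorial_succ, Nat.factorial_succ]
    push_cast
    calc (0 * (hermiteR (n + 1)).eval 0 - ((n : ℝ) + 1) * (hermiteR n).eval 0) ^ 2
        = ((n : ℝ) + 1) * (((n : ℝ) + 1) * (hermiteR n).eval 0 ^ 2) := by ring
      _ ≤ ((n : ℝ) + 1 + 1) * (((n : ℝ) + 1) * n.factorial) := by gcongr; linarith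

theorem eval_zero_derivative_hermiteR_sq_le (n : ℕ) :
    (derivative (hermiteR n)).eval 0 ^ 2 ≤ n * n.factorial := by
  cases n with
  | zero => simp [hermiteR_zero]
  | succ n =>
    rw [derivative_hermiteR_succ, Nat.factorial_succ, eval_C_mul, mul_pow, sq, mul_assoc]
    push_cast
    gcongr
    exact eval_zero_hermiteR_sq_le n

/-- Sonin's function of the Hermite function `u = e^{-x²/4} He_n`, which solves
`u'' + q u = 0` with `q = n + 1/2 - x²/4`: it is `q u² + u'²`, written out in terms of `He_n`. -/
noncomputable def sonin (n : ℕ) (x : ℝ) : ℝ :=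
  Real.exp (-(x ^ 2 / 2)) * (((n : ℝ) + 1 / 2 - x ^ 2 / 4) * (hermiteR n).eval x ^ 2 +
    ((derivative (hermiteR n)).eval x - x / 2 * (hermiteR n).eval x) ^ 2)

theorem hasDerivAt_sonin (n : ℕ) (x : ℝ) :
    HasDerivAt (sonin n) (-(x / 2) * (Real.exp (-(x ^ 2 / 2)) * (hermiteR n).eval x ^ 2)) x := by
  have hH := (hermiteR n).hasDerivAt x
  have hH' := (derivative (hermiteR n)).hasDerivAt x
  rw [derivative_derivative_hermiteR] at hH'
  have hexp : HasDerivAt (fun x : ℝ => Real.exp (-(x ^ 2 / 2)))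
      (Real.exp (-(x ^ 2 / 2)) * -x) x := by
    convert! ((hasDerivAt_pow 2 x).div_const 2).neg.exp using 1
    simp
  have hq : HasDerivAt (fun x : ℝ => (n : ℝ) + 1 / 2 - x ^ 2 / 4) (-(x / 2)) x := by
    convert! ((hasDerivAt_pow 2 x).div_const 4).const_sub ((n : ℝ) + 1 / 2) using 1
    push_cast
    ring
  have hx : HasDerivAt (fun x : ℝ => x / 2) (1 / 2) x := (hasDerivAt_id x).div_const 2
  convert! hexp.fun_mul ((hq.fun_mul (hH.fun_pow 2)).fun_add
    ((hH'.fun_sub (hx.fun_mul hH)).fun_pow 2)) using 1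
  simp only [eval_sub, eval_mul, eval_X, eval_C]
  push_cast
  ring

theorem sonin_le_sonin_zero (n : ℕ) (x : ℝ) : sonin n x ≤ sonin n 0 := by
  have hd : Differentiable ℝ (sonin n) := fun x => (hasDerivAt_sonin n x).differentiableAt
  have hpos (x : ℝ) : 0 ≤ Real.exp (-(x ^ 2 / 2)) * (hermiteR n).eval x ^ 2 := by positivity
  rcases le_total 0 x with hx | hx
  · have hanti : AntitoneOn (sonin n) (Set.Ici 0) :=
      antitoneOn_of_deriv_nonpos (convex_Ici 0) hd.continuous.continuousOn hd.differentiableOn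
        fun y hy => by
          rw [interior_Ici, Set.mem_Ioi] at hy
          rw [(hasDerivAt_sonin n y).deriv]
          exact mul_nonpos_of_nonpos_of_nonneg (by linarith) (hpos y)
    exact hanti Set.self_mem_Ici hx hx
  · have hmono : MonotoneOn (sonin n) (Set.Iic 0) :=
      monotoneOn_of_deriv_nonneg (convex_Iic 0) hd.continuous.continuousOn hd.differentiableOn
        fun y hy => by
          rw [interior_Iic, Set.mem_Iio] at hy
          rw [(hasDerivAt_sonin n y).deriv]
          exact mul_nonneg (by linarith) (hpos y)
    exact hmono hx Set.self_mem_Iic hx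

theorem sonin_le (n : ℕ) (x : ℝ) : sonin n x ≤ (2 * n + 1) * n.factorial := by
  refine (sonin_le_sonin_zero n x).trans ?_
  have hzero : sonin n 0 = ((n : ℝ) + 1 / 2) * (hermiteR n).eval 0 ^ 2 +
      (derivative (hermiteR n)).eval 0 ^ 2 := by
    simp [sonin]
  calc sonin n 0 ≤ ((n : ℝ) + 1 / 2) * n.factorial + n * n.factorial := by
        rw [hzero]
        gcongr
        exacts [eval_zero_hermiteR_sq_le n, eval_zero_derivative_hermiteR_sq_le n]
    _ = (2 * n + 1 / 2) * n.factorial := by ring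
    _ ≤ (2 * n + 1) * n.factorial := by gcongr; norm_num

theorem exp_mul_sq_eval_hermiteR_le {n : ℕ} {x : ℝ} (hx : x ^ 2 ≤ 2 * n) :
    Real.exp (-(x ^ 2 / 2)) * (hermiteR n).eval x ^ 2 ≤ 4 * n.factorial := by
  set E := Real.exp (-(x ^ 2 / 2)) with hE
  set H := (hermiteR n).eval x
  have hsonin : ((n : ℝ) + 1) / 2 * (E * H ^ 2) ≤ sonin n x := by
    have hsq : 0 ≤ E * ((derivative (hermiteR n)).eval x - x / 2 * H) ^ 2 := by positivity
    calc ((n : ℝ) + 1) / 2 * (E * H ^ 2)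
        ≤ ((n : ℝ) + 1 / 2 - x ^ 2 / 4) * (E * H ^ 2) := by gcongr; linarith
      _ ≤ sonin n x := by rw [sonin, ← hE]; linarith
  refine le_of_mul_le_mul_left ?_ (by positivity : (0 : ℝ) < ((n : ℝ) + 1) / 2)
  calc ((n : ℝ) + 1) / 2 * (E * H ^ 2) ≤ (2 * n + 1) * n.factorial := hsonin.trans (sonin_le n x)
    _ ≤ (2 * n + 2) * n.factorial := by gcongr; norm_num
    _ = ((n : ℝ) + 1) / 2 * (4 * n.factorial) := by ring

theorem abs_eval_hermiteR_le {n : ℕ} {x : ℝ} (hx : x ^ 2 ≤ 2 * n) :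
    |(hermiteR n).eval x| ≤ 2 * √(n.factorial : ℝ) * Real.exp (x ^ 2 / 4) := by
  have hexp : Real.exp (x ^ 2 / 4) ^ 2 * Real.exp (-(x ^ 2 / 2)) = 1 := by
    rw [← Real.exp_nat_mul, ← Real.exp_add, Real.exp_eq_one_iff]
    push_cast
    ring
  refine abs_le_of_sq_le_sq ?_ (by positivity)
  calc (hermiteR n).eval x ^ 2
      = Real.exp (x ^ 2 / 4) ^ 2 * (Real.exp (-(x ^ 2 / 2)) * (hermiteR n).eval x ^ 2) := by
        rw [← mul_assoc, hexp, one_mul]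
    _ ≤ Real.exp (x ^ 2 / 4) ^ 2 * (4 * n.factorial) := by
        exact mul_le_mul_of_nonneg_left (exp_mul_sq_eval_hermiteR_le hx) (by positivity)
    _ = (2 * √(n.factorial : ℝ) * Real.exp (x ^ 2 / 4)) ^ 2 := by
        rw [mul_pow, mul_pow, Real.sq_sqrt (by positivity)]
        ring

end Cramer

section FourierUniqueness

variable {E : Type*} [NormedAddCommGroup E] [InnerProductSpace ℝ E] [MeasurableSpace E]
  {μ : Measure E} {f : E → ℝ}

theorem charFun_withDensity_ofReal (hf : AEMeasurable f μ) (t : E) :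
    charFun (μ.withDensity fun x => ENNReal.ofReal (f x)) t =
      ∫ x, Complex.exp (inner ℝ x t * Complex.I) * (max (f x) 0 : ℝ) ∂μ := by
  rw [charFun_apply, integral_withDensity_eq_integral_toReal_smul₀ hf.ennreal_ofReal
    (ae_of_all _ fun x => ENNReal.ofReal_lt_top)]
  congr 1 with x
  rw [ENNReal.toReal_ofReal', Complex.real_smul, mul_comm]

variable [BorelSpace E]

theorem integrable_cexp_inner_mul (hf : Integrable f μ) (t : E) :
    Integrable (fun x => Complex.exp (inner ℝ x t * Complex.I) * f x) μ :=
  hf.ofReal.bdd_mul (c := 1) (Continuous.aestronglyMeasurable (by fun_prop))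
    (ae_of_all _ fun x => (Complex.norm_exp_ofReal_mul_I (inner ℝ x t)).le)

theorem ae_eq_zero_of_forall_integral_cexp_inner_mul_eq_zero [CompleteSpace E]
    [SecondCountableTopology E] (hf : Integrable f μ)
    (h : ∀ t : E, ∫ x, Complex.exp (inner ℝ x t * Complex.I) * f x ∂μ = 0) : f =ᵐ[μ] 0 := by
  have hm : AEMeasurable f μ := hf.aestronglyMeasurable.aemeasurable
  have := isFiniteMeasure_withDensity_ofReal hf.2
  have := isFiniteMeasure_withDensity_ofReal hf.neg.2
  have hchar : charFun (μ.withDensity fun x => ENNReal.ofReal (f x)) =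
      charFun (μ.withDensity fun x => ENNReal.ofReal ((-f) x)) := by
    ext t
    rw [charFun_withDensity_ofReal hm, charFun_withDensity_ofReal hm.neg, ← sub_eq_zero, ← h t]
    simp only [Pi.neg_apply]
    rw [← integral_sub (integrable_cexp_inner_mul hf.pos_part t)
        (integrable_cexp_inner_mul hf.neg_part t)]
    simp only [← mul_sub, ← Complex.ofReal_sub, max_zero_sub_max_neg_zero_eq_self]
  have hdensity := (withDensity_eq_iff hm.ennreal_ofReal hm.neg.ennreal_ofReal
    hf.lintegral_lt_top.ne).1 (Measure.ext_of_charFun hchar)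
  filter_upwards [hdensity] with x hx
  have hmax : max (f x) 0 = max (-f x) 0 := by
    simpa only [ENNReal.toReal_ofReal', Pi.neg_apply] using congrArg ENNReal.toReal hx
  rw [Pi.zero_apply, ← max_zero_sub_max_neg_zero_eq_self (f x), hmax, sub_self]

end FourierUniqueness

section Completeness

open Filter Topology

variable {μ : Measure ℝ} {f g : ℝ → ℝ}

theorem integral_cexp_mul_eq_zero_of_integral_mul_pow_eq_zero (hm : AEStronglyMeasurable f μ)
    {t : ℝ} (hexp : Integrable (fun x => Real.exp |t * x| * |f x|) μ)
    (h : ∀ k : ℕ, ∫ x, f x * x ^ k ∂μ = 0) :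
    ∫ x : ℝ, Complex.exp (t * x * Complex.I) * f x ∂μ = 0 := by
  have hsum (x : ℝ) : HasSum (fun k : ℕ => (t * x * Complex.I) ^ k / k.factorial * (f x : ℂ))
      (Complex.exp (t * x * Complex.I) * f x) := by
    rw [Complex.exp_eq_exp_ℂ]
    exact (NormedSpace.expSeries_div_hasSum_exp (t * x * Complex.I : ℂ)).mul_right _
  have hbound (x : ℝ) : HasSum (fun k : ℕ => |t * x| ^ k / k.factorial * |f x|)
      (Real.exp |t * x| * |f x|) := by
    rw [Real.exp_eq_exp_ℝ]
    exact (NormedSpace.expSeries_div_hasSum_exp |t * x|).mul_right _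
  have hterm (k : ℕ) :
      ∫ x : ℝ, (t * x * Complex.I) ^ k / k.factorial * (f x : ℂ) ∂μ = 0 := by
    have hfactor (x : ℝ) : (t * x * Complex.I) ^ k / k.factorial * (f x : ℂ) =
        (t * Complex.I) ^ k / k.factorial * ((f x * x ^ k : ℝ) : ℂ) := by
      push_cast
      ring
    simp only [hfactor]
    rw [integral_const_mul, integral_complex_ofReal, h k, Complex.ofReal_zero, mul_zero]
  have hint := hasSum_integral_of_dominated_convergence
    (F := fun (k : ℕ) (x : ℝ) => (t * x * Complex.I) ^ k / k.factorial * (f x : ℂ))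
    (f := fun x : ℝ => Complex.exp (t * x * Complex.I) * f x)
    (fun k x => |t * x| ^ k / k.factorial * |f x|)
    (fun k => (Continuous.aestronglyMeasurable (by fun_prop)).mul
      (Complex.continuous_ofReal.comp_aestronglyMeasurable hm))
    (fun k => ae_of_all μ fun x => by simp [abs_mul, mul_pow])
    (ae_of_all _ fun x => (hbound x).summable)
    (by simpa only [(hbound _).tsum_eq] using hexp) (ae_of_all _ hsum)
  simp only [hterm] at hint
  exact hint.unique hasSum_zero

theorem memLp_exp_abs_mul_gaussianReal (t : ℝ) : MemLp (fun x => Real.exp |t * x|) 2 γ := by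
  rw [memLp_two_iff_integrable_sq (by fun_prop)]
  convert! integrable_exp_abs_mul_abs (X := id)
    (integrable_exp_mul_gaussianReal (μ := 0) (v := 1) (2 * t))
    (integrable_exp_mul_gaussianReal (μ := 0) (v := 1) (-(2 * t))) using 2 with x
  rw [← Real.exp_nat_mul, abs_mul, abs_mul, id_eq, abs_two, Nat.cast_ofNat, mul_assoc]

theorem ae_eq_zero_of_integral_mul_pow_eq_zero (hf : MemLp f 2 γ)
    (h : ∀ k : ℕ, ∫ x, f x * x ^ k ∂γ = 0) : f =ᵐ[γ] 0 := by
  refine ae_eq_zero_of_forall_integral_cexp_inner_mul_eq_zero (hf.integrable one_le_two)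
    fun t => ?_
  have hexp := (memLp_exp_abs_mul_gaussianReal t).integrable_mul hf.abs
  simpa using integral_cexp_mul_eq_zero_of_integral_mul_pow_eq_zero hf.aestronglyMeasurable hexp h

open Polynomial in
theorem ae_eq_zero_of_integral_mul_hermiteR_eq_zero (hf : MemLp f 2 γ)
    (h : ∀ j : ℕ, ∫ x, f x * (hermiteR j).eval x ∂γ = 0) : f =ᵐ[γ] 0 := by
  have hi (p : ℝ[X]) : Integrable (fun x => f x * p.eval x) γ :=
    hf.integrable_mul ((PolyGrowth.eval p).memLp_two p.continuous.measurable)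
  have hmoment (k j : ℕ) : ∫ x, f x * (X ^ k * hermiteR j).eval x ∂γ = 0 := by
    induction k generalizing j with
    | zero => simpa only [pow_zero, one_mul] using h j
    | succ k ih =>
      simp only [X_pow_succ_mul_hermiteR, eval_add, eval_C_mul, mul_add, mul_left_comm _ (j : ℝ)]
      rw [integral_add (hi _) ((hi _).const_mul _), integral_const_mul, ih, ih, mul_zero, add_zero]
  refine ae_eq_zero_of_integral_mul_pow_eq_zero hf fun k => ?_
  simpa only [hermiteR_zero, mul_one, eval_pow, eval_X] using hmoment k 0

end Completeness

section HermiteSeries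

open Filter Topology

variable {g : ℝ → ℝ}

/-- The Hermite polynomials `He_j / √j!`, orthonormal for the standard Gaussian. -/
noncomputable def hermiteN (j : ℕ) (x : ℝ) : ℝ := (hermiteR j).eval x / √(j.factorial : ℝ)

/-- The Fourier coefficients of `g` in the orthonormal basis `hermiteN`. -/
noncomputable def hermiteCoeff (g : ℝ → ℝ) (j : ℕ) : ℝ := ∫ x, g x * hermiteN j x ∂γ

theorem hermiteCoeff_eq_div (g : ℝ → ℝ) (j : ℕ) :
    hermiteCoeff g j = (∫ x, g x * (hermiteR j).eval x ∂γ) / √(j.factorial : ℝ) := by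
  simp only [hermiteCoeff, hermiteN, ← mul_div_assoc]
  exact integral_div _ _

theorem continuous_hermiteN (j : ℕ) : Continuous (hermiteN j) :=
  (hermiteR j).continuous.div_const _

theorem polyGrowth_hermiteN (j : ℕ) : PolyGrowth (hermiteN j) := by
  unfold hermiteN
  simpa only [div_eq_mul_inv] using
    (PolyGrowth.eval (hermiteR j)).mul (PolyGrowth.const (√(j.factorial : ℝ))⁻¹)

theorem memLp_hermiteN (j : ℕ) : MemLp (hermiteN j) 2 γ :=
  (polyGrowth_hermiteN j).memLp_two (continuous_hermiteN j).measurable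

theorem abs_hermiteN_le {j : ℕ} {x : ℝ} (hx : x ^ 2 ≤ 2 * j) :
    |hermiteN j x| ≤ 2 * Real.exp (x ^ 2 / 4) := by
  have hpos : 0 < √(j.factorial : ℝ) := Real.sqrt_pos.2 (by positivity)
  rw [hermiteN, abs_div, abs_of_pos hpos, div_le_iff₀ hpos, mul_right_comm]
  exact abs_eval_hermiteR_le hx

/-- The function `hermiteN j` as an element of `L²`, where Hilbert bases live. -/
noncomputable def hermiteLp (j : ℕ) : Lp ℝ 2 γ := (memLp_hermiteN j).toLp

theorem inner_hermiteLp (hg : MemLp g 2 γ) (j : ℕ) :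
    inner ℝ (hermiteLp j) hg.toLp = hermiteCoeff g j := by
  rw [L2.inner_def]
  refine integral_congr_ae ?_
  filter_upwards [(memLp_hermiteN j).coeFn_toLp, hg.coeFn_toLp] with x hN hx
  rw [hermiteLp, hN, hx, Real.inner_apply, mul_comm]

theorem hermiteCoeff_hermiteN (i j : ℕ) :
    hermiteCoeff (hermiteN j) i = if i = j then 1 else 0 := by
  rw [hermiteCoeff_eq_div]
  simp only [hermiteN, div_mul_eq_mul_div, integral_div]
  split_ifs with hij
  · subst hij
    rw [integral_hermiteR_sq, div_div, Real.mul_self_sqrt (Nat.cast_nonneg _),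
      div_self (by positivity)]
  · rw [integral_hermiteR_mul_of_ne (Ne.symm hij), zero_div, zero_div]

theorem orthonormal_hermiteLp : Orthonormal ℝ hermiteLp :=
  orthonormal_iff_ite.2 fun i j =>
    (inner_hermiteLp (memLp_hermiteN j) i).trans (hermiteCoeff_hermiteN i j)

theorem sum_sq_hermiteCoeff_le (hg : MemLp g 2 γ) (s : Finset ℕ) :
    ∑ j ∈ s, hermiteCoeff g j ^ 2 ≤ ∫ x, g x ^ 2 ∂γ := by
  have hbessel := orthonormal_hermiteLp.sum_inner_products_le hg.toLp (s := s)
  simp only [inner_hermiteLp, Real.norm_eq_abs, sq_abs] at hbessel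
  refine hbessel.trans_eq ?_
  rw [← real_inner_self_eq_norm_sq, L2.inner_def]
  refine integral_congr_ae ?_
  filter_upwards [hg.coeFn_toLp] with x hx
  rw [hx, Real.inner_apply, sq]

theorem orthogonal_span_hermiteLp : (Submodule.span ℝ (Set.range hermiteLp))ᗮ = ⊥ := by
  rw [Submodule.eq_bot_iff]
  intro f hf
  refine Lp.eq_zero_iff_ae_eq_zero.2
    (ae_eq_zero_of_integral_mul_hermiteR_eq_zero (Lp.memLp f) fun j => ?_)
  have hcoeff : hermiteCoeff f j = 0 := by
    rw [← inner_hermiteLp (Lp.memLp f), Lp.toLp_coeFn]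
    exact (Submodule.mem_orthogonal _ _).1 hf _ (Submodule.subset_span ⟨j, rfl⟩)
  rw [hermiteCoeff_eq_div, div_eq_zero_iff] at hcoeff
  exact hcoeff.resolve_right (Real.sqrt_pos.2 (by positivity)).ne'

theorem coeFn_sum_smul_hermiteLp (c : ℕ → ℝ) (s : Finset ℕ) :
    (∑ j ∈ s, c j • hermiteLp j : Lp ℝ 2 γ) =ᵐ[γ] fun x => ∑ j ∈ s, c j * hermiteN j x := by
  refine (Lp.coeFn_finsetSum s _).trans ?_
  filter_upwards [ae_all_iff.2 fun j => Lp.coeFn_smul (c j) (hermiteLp j),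
    ae_all_iff.2 fun j => (memLp_hermiteN j).coeFn_toLp] with x hsmul hN
  rw [Finset.sum_apply]
  refine Finset.sum_congr rfl fun j _ => ?_
  rw [hsmul, Pi.smul_apply, hermiteLp, hN, smul_eq_mul]

theorem exists_strictMono_ae_tendsto_sum_hermiteN (hg : MemLp g 2 γ) :
    ∃ ns : ℕ → ℕ, StrictMono ns ∧ ∀ᵐ x ∂γ, Tendsto
      (fun k => ∑ j ∈ Finset.range (ns k), hermiteCoeff g j * hermiteN j x) atTop (𝓝 (g x)) := by
  have hs := ((HilbertBasis.mkOfOrthogonalEqBot orthonormal_hermiteLp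
    orthogonal_span_hermiteLp).hasSum_repr hg.toLp).tendsto_sum_nat
  simp only [HilbertBasis.repr_apply_apply, HilbertBasis.coe_mkOfOrthogonalEqBot,
    inner_hermiteLp] at hs
  obtain ⟨ns, hns, hlim⟩ := (tendstoInMeasure_of_tendsto_Lp hs).exists_seq_tendsto_ae
  refine ⟨ns, hns, ?_⟩
  filter_upwards [hlim, hg.coeFn_toLp, ae_all_iff.2 fun N =>
    coeFn_sum_smul_hermiteLp (hermiteCoeff g) (Finset.range N)] with x hx hgx hsum
  simpa only [hgx, hsum] using hx

theorem tendstoUniformlyOn_sum_hermiteN {c : ℕ → ℝ} (hc : Summable c) (R : ℝ) :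
    TendstoUniformlyOn (fun M x => ∑ j ∈ Finset.range M, c j * hermiteN j x)
      (fun x => ∑' j, c j * hermiteN j x) atTop (Metric.closedBall 0 R) := by
  refine tendstoUniformlyOn_tsum_nat_eventually
    (u := fun j => |c j| * (2 * Real.exp (R ^ 2 / 4))) (hc.abs.mul_right _) ?_
  filter_upwards [eventually_ge_atTop ⌈R ^ 2⌉₊] with j hj x hx
  rw [mem_closedBall_zero_iff, Real.norm_eq_abs] at hx
  have hxR : x ^ 2 ≤ R ^ 2 := sq_le_sq.2 (hx.trans (le_abs_self R))
  have hRj : R ^ 2 ≤ j := Nat.ceil_le.1 hj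
  rw [Real.norm_eq_abs, abs_mul]
  refine mul_le_mul_of_nonneg_left ((abs_hermiteN_le ?_).trans (by gcongr)) (abs_nonneg _)
  linarith [sq_nonneg R]

theorem continuous_tsum_hermiteN {c : ℕ → ℝ} (hc : Summable c) :
    Continuous fun x => ∑' j, c j * hermiteN j x := by
  refine continuous_iff_continuousAt.2 fun x => ?_
  have hon := (tendstoUniformlyOn_sum_hermiteN hc (|x| + 1)).continuousOn
    (Frequently.of_forall fun M => (continuous_finsetSum _ fun j _ =>
      (continuous_hermiteN j).const_mul _).continuousOn)
  exact hon.continuousAt (Metric.closedBall_mem_nhds_of_mem (by simp))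

/-- The uniform limit of the Hermite series is continuous, and it agrees almost everywhere with
the `L²` limit `g`. -/
theorem tendsto_sum_hermiteN (hg : MemLp g 2 γ) (hc : Continuous g)
    (hs : Summable (hermiteCoeff g)) (x : ℝ) :
    Tendsto (fun M => ∑ j ∈ Finset.range M, hermiteCoeff g j * hermiteN j x) atTop
      (𝓝 (g x)) := by
  have hpt (y : ℝ) := (tendstoUniformlyOn_sum_hermiteN hs |y|).tendsto_at (x := y) (by simp)
  obtain ⟨ns, hns, hlim⟩ := exists_strictMono_ae_tendsto_sum_hermiteN hg
  have hae : (fun x => ∑' j, hermiteCoeff g j * hermiteN j x) =ᵐ[γ] g := by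
    filter_upwards [hlim] with y hy
    exact tendsto_nhds_unique ((hpt y).comp hns.tendsto_atTop) hy
  have heq := (Continuous.ae_eq_iff_eq volume (continuous_tsum_hermiteN hs) hc).1
    ((gaussianReal_absolutelyContinuous' 0 one_ne_zero).ae_le hae)
  simpa only [congrFun heq x] using hpt x

end HermiteSeries

section CoefficientDecay

open Filter Topology Set

variable {m n : ℕ} {g : ℝ → ℝ}

theorem TemperedOn.exists_integral_mul_hermiteR_eq (hg : TemperedOn m g univ) :
    ∃ D : ℝ → ℝ, MemLp D 2 γ ∧ ∀ j, ∫ x, g x * (hermiteR (j + (m + 1))).eval x ∂γ =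
      ∫ x, D x * (hermiteR j).eval x ∂γ := by
  induction m generalizing g with
  | zero =>
    exact ⟨deriv g, hg.lipPolyOn.polyGrowth_deriv.memLp_two (measurable_deriv g),
      hg.lipPolyOn.integral_mul_hermiteR_succ⟩
  | succ m ih =>
    obtain ⟨hl, g', hd, hg'⟩ := hg
    obtain ⟨D, hD, hgD⟩ := ih hg'
    have hderiv : deriv g = g' := funext fun x => (hd x (mem_univ x)).deriv
    refine ⟨D, hD, fun j => ?_⟩
    rw [← hgD j, ← hderiv]
    exact hl.integral_mul_hermiteR_succ (j + (m + 1))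

theorem TemperedOn.exists_abs_hermiteCoeff_le (hg : TemperedOn m g univ) :
    ∃ D : ℝ → ℝ, MemLp D 2 γ ∧ ∀ j, |hermiteCoeff g (j + (m + 1))| ≤
      |hermiteCoeff D j| * √((((j : ℝ) + 1) ^ (m + 1))⁻¹) := by
  obtain ⟨D, hD, hgD⟩ := hg.exists_integral_mul_hermiteR_eq
  refine ⟨D, hD, fun j => ?_⟩
  have hfactorial : (j.factorial : ℝ) * ((j : ℝ) + 1) ^ (m + 1) ≤ (j + (m + 1)).factorial := by
    exact_mod_cast Nat.factorial_mul_pow_le_factorial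
  rw [hermiteCoeff_eq_div, hermiteCoeff_eq_div, hgD, abs_div, abs_div,
    abs_of_nonneg (Real.sqrt_nonneg _), abs_of_nonneg (Real.sqrt_nonneg _), Real.sqrt_inv,
    div_eq_mul_inv, div_eq_mul_inv, mul_assoc, ← mul_inv, ← Real.sqrt_mul (by positivity)]
  gcongr

theorem sum_Ico_inv_add_one_pow_le (hm : m ≠ 0) (hn : n ≠ 0) (M : ℕ) :
    ∑ i ∈ Finset.Ico n M, (((i : ℝ) + 1) ^ (m + 1))⁻¹ ≤ 2 * ((n : ℝ) ^ m)⁻¹ := by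
  obtain ⟨k, rfl⟩ := Nat.exists_eq_succ_of_ne_zero hm
  have : (0 : ℝ) < n := by exact_mod_cast Nat.pos_of_ne_zero hn
  have hsq : ∑ i ∈ Finset.Ico n M, (((i : ℝ) + 1) ^ 2)⁻¹ ≤ 2 * (n : ℝ)⁻¹ := by
    have h := sum_Ioo_inv_sq_le (α := ℝ) n (M + 1)
    have hIoo : Finset.Ioo n (M + 1) = Finset.Ico (n + 1) (M + 1) := by
      ext
      simp only [Finset.mem_Ioo, Finset.mem_Ico]
      lia
    rw [hIoo, ← Finset.sum_Ico_add'] at h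
    push_cast at h
    rw [← div_eq_mul_inv]
    exact h.trans (by gcongr; linarith)
  calc ∑ i ∈ Finset.Ico n M, (((i : ℝ) + 1) ^ (k + 1 + 1))⁻¹
      ≤ ∑ i ∈ Finset.Ico n M, ((n : ℝ) ^ k)⁻¹ * (((i : ℝ) + 1) ^ 2)⁻¹ := by
        refine Finset.sum_le_sum fun i hi => ?_
        have hni : (n : ℝ) ≤ i := by exact_mod_cast (Finset.mem_Ico.1 hi).1
        rw [← mul_inv, add_assoc k, pow_add]
        gcongr
        linarith
    _ ≤ ((n : ℝ) ^ k)⁻¹ * (2 * (n : ℝ)⁻¹) := by rw [← Finset.mul_sum]; gcongr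
    _ = 2 * ((n : ℝ) ^ (k + 1))⁻¹ := by rw [pow_succ, mul_inv]; ring

/-- Cauchy–Schwarz between the square-summable coefficients of the last derivative and the
weights gained by integrating by parts. -/
theorem TemperedOn.exists_sum_abs_hermiteCoeff_le (hg : TemperedOn m g univ) (hm : m ≠ 0) :
    ∃ B : ℝ, 0 ≤ B ∧ ∀ n M : ℕ, n ≠ 0 →
      ∑ i ∈ Finset.Ico n M, |hermiteCoeff g (i + (m + 1))| ≤ B * √(((n : ℝ) ^ m)⁻¹) := by
  obtain ⟨D, hD, hgD⟩ := hg.exists_abs_hermiteCoeff_le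
  set S := ∫ x, D x ^ 2 ∂γ
  refine ⟨√S * √2, by positivity, fun n M hn => ?_⟩
  calc ∑ i ∈ Finset.Ico n M, |hermiteCoeff g (i + (m + 1))|
      ≤ ∑ i ∈ Finset.Ico n M, |hermiteCoeff D i| * √((((i : ℝ) + 1) ^ (m + 1))⁻¹) :=
        Finset.sum_le_sum fun i _ => hgD i
    _ ≤ √(∑ i ∈ Finset.Ico n M, |hermiteCoeff D i| ^ 2) *
          √(∑ i ∈ Finset.Ico n M, √((((i : ℝ) + 1) ^ (m + 1))⁻¹) ^ 2) :=
        Real.sum_mul_le_sqrt_mul_sqrt _ _ _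
    _ ≤ √S * √(2 * ((n : ℝ) ^ m)⁻¹) := by
        have hsq (i : ℕ) : √((((i : ℝ) + 1) ^ (m + 1))⁻¹) ^ 2 = (((i : ℝ) + 1) ^ (m + 1))⁻¹ :=
          Real.sq_sqrt (by positivity)
        simp only [sq_abs, hsq]
        gcongr
        exacts [sum_sq_hermiteCoeff_le hD _, sum_Ico_inv_add_one_pow_le hm hn M]
    _ = √S * √2 * √(((n : ℝ) ^ m)⁻¹) := by rw [Real.sqrt_mul zero_le_two, mul_assoc]

theorem TemperedOn.exists_sum_range_abs_hermiteCoeff_le (hg : TemperedOn m g univ) (hm : m ≠ 0) :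
    ∃ B : ℝ, 0 ≤ B ∧ ∀ n M : ℕ, m < n →
      ∑ j ∈ Finset.range M, |hermiteCoeff g (j + 2 * n)| ≤ B * √(((n : ℝ) ^ m)⁻¹) := by
  obtain ⟨B, hB, h⟩ := hg.exists_sum_abs_hermiteCoeff_le hm
  refine ⟨B, hB, fun n M hn => ?_⟩
  obtain ⟨k, rfl⟩ := Nat.exists_eq_add_of_lt hn
  calc ∑ j ∈ Finset.range M, |hermiteCoeff g (j + 2 * (m + k + 1))|
      = ∑ i ∈ Finset.Ico (m + k + 1 + k) (m + k + 1 + k + M),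
          |hermiteCoeff g (i + (m + 1))| := by
        rw [Finset.sum_Ico_eq_sum_range, Nat.add_sub_cancel_left]
        refine Finset.sum_congr rfl fun j _ => ?_
        congr 2
        ring
    _ ≤ ∑ i ∈ Finset.Ico (m + k + 1) (m + k + 1 + k + M), |hermiteCoeff g (i + (m + 1))| :=
        Finset.sum_le_sum_of_subset_of_nonneg (Finset.Ico_subset_Ico_left (by lia))
          fun _ _ _ => abs_nonneg _
    _ ≤ B * √((((m + k + 1 : ℕ) : ℝ) ^ m)⁻¹) := h _ _ (by lia)

theorem TemperedOn.summable_hermiteCoeff (hg : TemperedOn m g univ) (hm : m ≠ 0) :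
    Summable (hermiteCoeff g) := by
  obtain ⟨B, -, h⟩ := hg.exists_sum_range_abs_hermiteCoeff_le hm
  have htail := summable_of_sum_range_le (fun _ => abs_nonneg _) fun M => h (m + 1) M (by lia)
  exact (summable_nat_add_iff (2 * (m + 1))).1 htail.of_abs

end CoefficientDecay

section QuadratureError

open Filter Topology Set

variable {m n : ℕ} {g : ℝ → ℝ}

theorem hermiteCoeff_zero (g : ℝ → ℝ) : hermiteCoeff g 0 = ∫ x, g x ∂γ := by
  simp [hermiteCoeff, hermiteN, hermiteR_zero]

theorem gaussHermite_hermiteN_of_lt {j : ℕ} (hj : j < 2 * n) :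
    gaussHermite n 1 (hermiteN j) = if j = 0 then 1 else 0 := by
  have hN : hermiteN j = fun x => (√(j.factorial : ℝ))⁻¹ * (hermiteR j).eval x := by
    ext x
    rw [hermiteN, div_eq_inv_mul]
  rw [hN, gaussHermite_const_mul, gaussHermite_eval_of_natDegree_lt (by rwa [natDegree_hermiteR])]
  split_ifs with h
  · subst h
    simp [hermiteR_zero]
  · have horth := integral_hermiteR_mul_of_ne (Ne.symm h)
    simp only [hermiteR_zero, Polynomial.eval_one, one_mul] at horth
    rw [horth, mul_zero]

theorem abs_gaussHermite_hermiteN_le {j : ℕ} (hj : 2 * n ≤ j) :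
    |gaussHermite n 1 (hermiteN j)| ≤ 2 * ∫ x, Real.exp (x ^ 2 / 4) ∂γ := by
  have hj' : (2 * n : ℝ) ≤ j := by exact_mod_cast hj
  calc |gaussHermite n 1 (hermiteN j)|
      ≤ gaussHermite n 1 fun x => 2 * Real.exp (x ^ 2 / 4) :=
        abs_gaussHermite_one_le fun x hx =>
          abs_hermiteN_le (by linarith [sq_lt_of_mem_hermiteNodes hx])
    _ ≤ 2 * ∫ x, Real.exp (x ^ 2 / 4) ∂γ := by
        rw [gaussHermite_const_mul]
        exact mul_le_mul_of_nonneg_left (gaussHermite_exp_le n) zero_le_two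

theorem gaussHermite_sum_range_hermiteN (hn : n ≠ 0) (M : ℕ) (c : ℕ → ℝ) :
    gaussHermite n 1 (fun x => ∑ j ∈ Finset.range (2 * n + M), c j * hermiteN j x) =
      c 0 + ∑ j ∈ Finset.range M, c (j + 2 * n) * gaussHermite n 1 (hermiteN (j + 2 * n)) := by
  rw [gaussHermite_sum, Finset.sum_range_add]
  simp only [gaussHermite_const_mul, add_comm (2 * n)]
  congr 1
  rw [Finset.sum_eq_single_of_mem 0 (by simpa using Nat.pos_of_ne_zero hn),
    gaussHermite_hermiteN_of_lt (by lia), if_pos rfl, mul_one]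
  intro j hj hj0
  rw [gaussHermite_hermiteN_of_lt (Finset.mem_range.1 hj), if_neg hj0, mul_zero]

theorem tendsto_gaussHermite {f : ℕ → ℝ → ℝ} (h : ∀ x, Tendsto (fun M => f M x) atTop (𝓝 (g x))) :
    Tendsto (fun M => gaussHermite n 1 (f M)) atTop (𝓝 (gaussHermite n 1 g)) := by
  simp only [gaussHermite_one]
  exact tendsto_finsetSum _ fun x _ => (h x).const_mul _

theorem abs_gaussHermite_sub_integral_le_of_sum_le (hg : MemLp g 2 γ) (hc : Continuous g)
    (hs : Summable (hermiteCoeff g)) (hn : n ≠ 0) {B : ℝ}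
    (hB : ∀ M, ∑ j ∈ Finset.range M, |hermiteCoeff g (j + 2 * n)| ≤ B) :
    |gaussHermite n 1 g - ∫ x, g x ∂γ| ≤ (2 * ∫ x, Real.exp (x ^ 2 / 4) ∂γ) * B := by
  have hlim := (tendsto_gaussHermite (n := n) (tendsto_sum_hermiteN hg hc hs)).comp
    (tendsto_add_atTop_nat (2 * n))
  refine le_of_tendsto' (hlim.sub_const _).abs fun M => ?_
  rw [Function.comp_apply, add_comm M, gaussHermite_sum_range_hermiteN hn, hermiteCoeff_zero,
    add_sub_cancel_left]
  set K := 2 * ∫ x, Real.exp (x ^ 2 / 4) ∂γ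
  have hK : 0 ≤ K := mul_nonneg zero_le_two (integral_nonneg fun x => (Real.exp_pos _).le)
  calc |∑ j ∈ Finset.range M, hermiteCoeff g (j + 2 * n) * gaussHermite n 1 (hermiteN (j + 2 * n))|
      ≤ ∑ j ∈ Finset.range M, K * |hermiteCoeff g (j + 2 * n)| := by
        refine (Finset.abs_sum_le_sum_abs _ _).trans (Finset.sum_le_sum fun j _ => ?_)
        rw [abs_mul, mul_comm]
        exact mul_le_mul_of_nonneg_right (abs_gaussHermite_hermiteN_le (Nat.le_add_left _ _))
          (abs_nonneg _)
    _ ≤ K * B := by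
        rw [← Finset.mul_sum]
        exact mul_le_mul_of_nonneg_left (hB M) hK

theorem PolyGrowth.exists_abs_le_mul_exp (hg : PolyGrowth g) :
    ∃ C : ℝ, 0 ≤ C ∧ ∀ x, |g x| ≤ C * Real.exp (x ^ 2 / 4) := by
  obtain ⟨C, N, hC, h⟩ := hg
  refine ⟨C * (N.factorial * Real.exp 2), by positivity, fun x => (h x).trans ?_⟩
  have hexp := Real.pow_div_factorial_le_exp (1 + |x|) (by positivity) N
  rw [div_le_iff₀' (by positivity)] at hexp
  have hquad : 1 + |x| ≤ 2 + x ^ 2 / 4 := by nlinarith [sq_nonneg (|x| - 2), sq_abs x]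
  calc C * (1 + |x|) ^ N ≤ C * (N.factorial * Real.exp (1 + |x|)) := by gcongr
    _ ≤ C * (N.factorial * Real.exp (2 + x ^ 2 / 4)) := by grw [hquad]
    _ = C * (N.factorial * Real.exp 2) * Real.exp (x ^ 2 / 4) := by rw [Real.exp_add]; ring

theorem PolyGrowth.exists_abs_gaussHermite_sub_integral_le (hg : PolyGrowth g) :
    ∃ B : ℝ, ∀ n : ℕ, |gaussHermite n 1 g - ∫ x, g x ∂γ| ≤ B := by
  obtain ⟨C, hC, h⟩ := hg.exists_abs_le_mul_exp
  refine ⟨C * (∫ x, Real.exp (x ^ 2 / 4) ∂γ) + |∫ x, g x ∂γ|,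
    fun n => (abs_sub _ _).trans (add_le_add_left ?_ _)⟩
  refine (abs_gaussHermite_one_le fun x _ => h x).trans ?_
  rw [gaussHermite_const_mul]
  exact mul_le_mul_of_nonneg_left (gaussHermite_exp_le n) hC

theorem rpow_neg_natCast_div_two {x : ℝ} (hx : 0 ≤ x) (m : ℕ) :
    x ^ (-(m : ℝ) / 2) = √((x ^ m)⁻¹) := by
  rw [Real.sqrt_eq_rpow, ← Real.rpow_natCast, ← Real.rpow_neg hx, ← Real.rpow_mul hx, mul_one_div]

theorem TemperedOn.gaussHermite_one_sub_integral_isBigO (hg : TemperedOn m g univ) :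
    (fun n : ℕ => gaussHermite n 1 g - ∫ x, g x ∂γ) =O[atTop]
      fun n : ℕ => (n : ℝ) ^ (-(m : ℝ) / 2) := by
  have hgrowth := hg.lipPolyOn.polyGrowth
  have hc := hg.lipPolyOn.continuous
  rcases eq_or_ne m 0 with rfl | hm
  · obtain ⟨B, hB⟩ := hgrowth.exists_abs_gaussHermite_sub_integral_le
    refine IsBigO.of_bound B (Eventually.of_forall fun n => ?_)
    simpa using hB n
  · obtain ⟨B, -, hB⟩ := hg.exists_sum_range_abs_hermiteCoeff_le hm
    refine IsBigO.of_bound ((2 * ∫ x, Real.exp (x ^ 2 / 4) ∂γ) * B) ?_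
    filter_upwards [eventually_gt_atTop m] with n hn
    rw [Real.norm_eq_abs, Real.norm_of_nonneg (by positivity),
      rpow_neg_natCast_div_two n.cast_nonneg, mul_assoc]
    exact abs_gaussHermite_sub_integral_le_of_sum_le (hgrowth.memLp_two hc.measurable) hc
      (hg.summable_hermiteCoeff hm) (by lia) fun M => hB n M hn

end QuadratureError

section Convolution

open Filter Topology Set

variable {m : ℕ} {μ : ℝ} {v : ℝ≥0} {f f' : ℝ → ℝ} {J : Set ℝ}

theorem one_add_abs_sub_le (z x : ℝ) : 1 + |z - x| ≤ (1 + |z|) * (1 + |x|) := by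
  linarith [abs_sub z x, mul_nonneg (abs_nonneg z) (abs_nonneg x)]

theorem PolyGrowth.comp_const_sub (hf : PolyGrowth f) (z : ℝ) : PolyGrowth fun x => f (z - x) := by
  obtain ⟨C, N, hC, hf⟩ := hf
  refine ⟨C * (1 + |z|) ^ N, N, by positivity, fun x => (hf _).trans ?_⟩
  rw [mul_assoc, ← mul_pow]
  gcongr
  exact one_add_abs_sub_le z x

theorem PolyGrowth.integrable_comp_const_sub (hf : PolyGrowth f) (hm : Measurable f) (z : ℝ) :
    Integrable (fun x => f (z - x)) (gaussianReal μ v) :=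
  (hf.comp_const_sub z).integrable (hm.comp (measurable_id.const_sub z))

theorem LipPolyOn.integral_comp_sub (hf : LipPolyOn f univ) :
    LipPolyOn (fun z => ∫ x, f (z - x) ∂(gaussianReal μ v)) univ := by
  have hi := hf.polyGrowth.integrable_comp_const_sub (μ := μ) (v := v) hf.continuous.measurable
  obtain ⟨C, N, hC, hf⟩ := hf
  set I := ∫ x, (2 * (1 + |x|)) ^ N ∂(gaussianReal μ v)
  have : 0 ≤ I := integral_nonneg fun x => by positivity
  have hint : Integrable (fun x : ℝ => (2 * (1 + |x|)) ^ N) (gaussianReal μ v) := by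
    simp only [mul_pow]
    exact (integrable_one_add_abs_pow_gaussianReal N).const_mul _
  have hshift (z y x : ℝ) : 1 + |z - x| + |y - x| ≤ (1 + |z| + |y|) * (2 * (1 + |x|)) := by
    nlinarith [abs_sub z x, abs_sub y x, abs_nonneg x, abs_nonneg y, abs_nonneg z]
  have hbound (z y x : ℝ) : |f (z - x) - f (y - x)| ≤
      C * |z - y| * (1 + |z| + |y|) ^ N * (2 * (1 + |x|)) ^ N := by
    have h := hf (z - x) (mem_univ _) (y - x) (mem_univ _)
    rw [sub_sub_sub_cancel_right] at h
    rw [mul_assoc _ (_ ^ N), ← mul_pow]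
    exact h.trans (by gcongr; exact hshift z y x)
  refine ⟨C * I, N, by positivity, fun z _ y _ => ?_⟩
  calc |(∫ x, f (z - x) ∂(gaussianReal μ v)) - ∫ x, f (y - x) ∂(gaussianReal μ v)|
      = ‖∫ x, (f (z - x) - f (y - x)) ∂(gaussianReal μ v)‖ := by
        rw [integral_sub (hi z) (hi y), Real.norm_eq_abs]
    _ ≤ ∫ x, C * |z - y| * (1 + |z| + |y|) ^ N * (2 * (1 + |x|)) ^ N ∂(gaussianReal μ v) :=
        norm_integral_le_of_norm_le (hint.const_mul _) (ae_of_all _ (hbound z y))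
    _ = C * I * |z - y| * (1 + |z| + |y|) ^ N := by rw [integral_const_mul]; ring

theorem hasDerivAt_integral_comp_sub (hf : PolyGrowth f) (hf' : PolyGrowth f')
    (hm : Measurable f') (hd : ∀ x, HasDerivAt f (f' x) x) (z : ℝ) :
    HasDerivAt (fun z => ∫ x, f (z - x) ∂(gaussianReal μ v))
      (∫ x, f' (z - x) ∂(gaussianReal μ v)) z := by
  have hmf : Measurable f := (continuous_iff_continuousAt.2 fun x => (hd x).continuousAt).measurable
  have hi := hf.integrable_comp_const_sub (μ := μ) (v := v) hmf
  obtain ⟨C, N, hC, hf'⟩ := hf'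
  have hbound (x y : ℝ) (hy : y ∈ Metric.ball z 1) :
      |f' (y - x)| ≤ C * (2 + |z|) ^ N * (1 + |x|) ^ N := by
    have hyz : 1 + |y| ≤ 2 + |z| := by
      rw [mem_ball_iff_norm, Real.norm_eq_abs] at hy
      linarith [abs_sub_abs_le_abs_sub y z]
    rw [mul_assoc, ← mul_pow]
    refine (hf' _).trans ?_
    gcongr
    exact (one_add_abs_sub_le y x).trans (by gcongr)
  exact (hasDerivAt_integral_of_dominated_loc_of_deriv_le (Metric.ball_mem_nhds z one_pos)
    (F := fun z x => f (z - x)) (F' := fun z x => f' (z - x))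
    (Eventually.of_forall fun y => (hi y).aestronglyMeasurable) (hi z)
    (hm.comp (measurable_id.const_sub z)).aestronglyMeasurable (ae_of_all _ hbound)
    ((integrable_one_add_abs_pow_gaussianReal N).const_mul _)
    (ae_of_all _ fun x y _ => (hd (y - x)).comp_sub_const y x)).2

theorem TemperedOn.integral_comp_sub (hf : TemperedOn m f univ) :
    TemperedOn m (fun z => ∫ x, f (z - x) ∂(gaussianReal μ v)) univ := by
  induction m generalizing f with
  | zero => exact LipPolyOn.integral_comp_sub hf
  | succ m ih =>
    obtain ⟨hl, f', hd, hf'⟩ := hf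
    exact ⟨hl.integral_comp_sub, _, fun z _ => hasDerivAt_integral_comp_sub hl.polyGrowth
      hf'.lipPolyOn.polyGrowth hf'.lipPolyOn.continuous.measurable (fun x => hd x (mem_univ x)) z,
      ih hf'⟩

theorem heatConv_eq_integral (hv : v ≠ 0) (f : ℝ → ℝ) (z : ℝ) :
    heatConv v f z = ∫ x, f (z - x) ∂(gaussianReal 0 v) :=
  (integral_gaussianReal_eq_integral_mul hv fun x => f (z - x)).symm

theorem temperedOn_heatConv (hf : TemperedOn m f univ) (hv : v ≠ 0) :
    TemperedOn m (heatConv v f) univ := by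
  rw [funext (heatConv_eq_integral hv f)]
  exact hf.integral_comp_sub

/-- In dimension one every convex set is strictly convex, so an average of values in `closure J`
lies in the interior unless the values are almost everywhere constant. -/
theorem heatConv_mem (hv : v ≠ 0) (hJ : J.OrdConnected) (hJo : IsOpen J) (hf : PolyGrowth f)
    (hc : Continuous f) (hfJ : ∀ x, f x ∈ closure J) {a : ℝ} (ha : f a ∈ J) (z : ℝ) :
    heatConv v f z ∈ J := by
  have hint := hf.integrable_comp_const_sub (μ := 0) (v := v) hc.measurable z
  have hcz : Continuous fun x => f (z - x) := by fun_prop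
  have hconvex : Convex ℝ J := hJ.convex
  have hinterior : interior (closure J) = J := by
    rw [hconvex.interior_closure_eq_interior_of_nonempty_interior
      (by rw [hJo.interior_eq]; exact ⟨_, ha⟩), hJo.interior_eq]
  rw [heatConv_eq_integral hv, ← average_eq_integral]
  rcases hconvex.closure.ordConnected.strictConvex.ae_eq_const_or_average_mem_interior
    isClosed_closure (ae_of_all _ fun x => hfJ (z - x)) hint with hconst | hmem
  · have heq : ∀ x, f (z - x) = ⨍ x, f (z - x) ∂(gaussianReal 0 v) := congrFun <|
      (hcz.ae_eq_iff_eq volume continuous_const).1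
        ((gaussianReal_absolutelyContinuous' 0 hv).ae_le hconst)
    rw [← heq (z - a), sub_sub_cancel]
    exact ha
  · rwa [hinterior] at hmem

theorem IsCDF.mem_closure_Ioo (hf : IsCDF f) (x : ℝ) : f x ∈ closure (Ioo (0 : ℝ) 1) := by
  obtain ⟨μ, _, h⟩ := hf
  rw [closure_Ioo zero_ne_one, h]
  exact ⟨cdf_nonneg μ x, cdf_le_one μ x⟩

theorem IsCDF.exists_mem_Ioo (hf : IsCDF f) (hc : Continuous f) : ∃ a, f a ∈ Ioo (0 : ℝ) 1 := by
  obtain ⟨μ, _, h⟩ := hf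
  obtain rfl : f = cdf μ := funext h
  obtain ⟨a, ha⟩ := mem_range_of_exists_le_of_exists_ge hc
    ((tendsto_cdf_atBot μ).eventually_le_const one_half_pos).exists
    ((tendsto_cdf_atTop μ).eventually_const_le one_half_lt_one).exists
  exact ⟨a, by rw [ha]; norm_num⟩

end Convolution

section Sobolev

open Filter Polynomial Set

variable {m k : ℕ} {v : ℝ≥0} {f g g' φ : ℝ → ℝ}

theorem contDiff_infty_iteratedDeriv (hφ : ContDiff ℝ ∞ φ) (k : ℕ) :
    ContDiff ℝ ∞ (iteratedDeriv k φ) := by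
  rw [iteratedDeriv_eq_iterate]
  exact hφ.iterate_deriv k

theorem hasCompactSupport_iteratedDeriv (hs : HasCompactSupport φ) (k : ℕ) :
    HasCompactSupport (iteratedDeriv k φ) := by
  induction k with
  | zero => simpa using hs
  | succ k ih => simpa only [iteratedDeriv_succ] using ih.deriv

theorem integral_mul_deriv_of_hasCompactSupport (hc : Continuous g')
    (hd : ∀ x, HasDerivAt g (g' x) x) (hφ : ContDiff ℝ ∞ φ) (hs : HasCompactSupport φ) :
    ∫ x, g x * deriv φ x = -∫ x, g' x * φ x := by
  have hg : Continuous g := continuous_iff_continuousAt.2 fun x => (hd x).continuousAt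
  have hφ' := contDiff_infty_iff_deriv.1 hφ
  exact integral_mul_deriv_eq_deriv_mul_of_integrable (fun x _ => hd x)
    (fun x _ => (hφ'.1 x).hasDerivAt)
    ((hg.mul hφ'.2.continuous).integrable_of_hasCompactSupport hs.deriv.mul_left)
    ((hc.mul hφ.continuous).integrable_of_hasCompactSupport hs.mul_left)
    ((hg.mul hφ.continuous).integrable_of_hasCompactSupport hs.mul_left)

theorem TemperedOn.exists_hasWeakDeriv (hg : TemperedOn k g univ) :
    ∃ u, LipPolyOn u univ ∧ HasWeakDeriv k g u := by
  induction k generalizing g with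
  | zero =>
    have hc := (LipPolyOn.continuous hg).locallyIntegrable (μ := volume)
    exact ⟨g, hg, hc, hc, fun φ _ _ => by simp⟩
  | succ k ih =>
    obtain ⟨hl, g', hd, hg'⟩ := hg
    obtain ⟨u, hu, -, hui, h⟩ := ih hg'
    refine ⟨u, hu, hl.continuous.locallyIntegrable, hui, fun φ hφ hs => ?_⟩
    rw [iteratedDeriv_succ, integral_mul_deriv_of_hasCompactSupport hg'.lipPolyOn.continuous
      (fun x => hd x (mem_univ x)) (contDiff_infty_iteratedDeriv hφ k)
      (hasCompactSupport_iteratedDeriv hs k), h φ hφ hs, pow_succ]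
    ring

theorem TemperedOn.memGaussianSobolev (hg : TemperedOn m g univ) : MemGaussianSobolev m v g := by
  refine ⟨hg.lipPolyOn.polyGrowth.memLp_two hg.lipPolyOn.continuous.measurable, fun k _ hk => ?_⟩
  obtain ⟨u, hu, h⟩ := (hg.of_le hk).exists_hasWeakDeriv
  exact ⟨u, h, hu.polyGrowth.memLp_two hu.continuous.measurable⟩

end Sobolev

section Main

open Filter Polynomial Set

variable {m : ℕ} {v : ℝ≥0} {f g : ℝ → ℝ}

theorem gaussHermite_eq_gaussHermite_one (n : ℕ) (v : ℝ≥0) (f : ℝ → ℝ) :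
    gaussHermite n v f = gaussHermite n 1 fun x => f (√(v : ℝ) * x) := by
  simp [gaussHermite]

theorem integral_gaussianReal_eq_integral_one (hf : Continuous f) :
    ∫ x, f x ∂(gaussianReal 0 v) = ∫ x, f (√(v : ℝ) * x) ∂γ := by
  have hvar : (.mk (√(v : ℝ) ^ 2) (sq_nonneg _) * 1 : ℝ≥0) = v := by
    ext
    simp
  have hmap := gaussianReal_map_const_mul (μ := 0) (v := 1) (√(v : ℝ))
  rw [mul_zero, hvar] at hmap
  rw [← hmap, integral_map (by fun_prop) hf.aestronglyMeasurable]

theorem TemperedOn.comp_const_mul (hg : TemperedOn m g univ) (a : ℝ) :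
    TemperedOn m (fun x => g (a * x)) univ := by
  have h := hg.comp (temperedOn_eval m (C a * X)) fun _ => mem_univ _
  simpa only [eval_mul, eval_C, eval_X] using h

theorem TemperedOn.comp_const_sub (hg : TemperedOn m g univ) (w : ℝ) :
    TemperedOn m (fun x => g (w - x)) univ := by
  have h := hg.comp (temperedOn_eval m (C w - X)) fun _ => mem_univ _
  simpa only [eval_sub, eval_C, eval_X] using h

theorem TemperedOn.gaussHermite_sub_integral_isBigO (hg : TemperedOn m g univ) :
    (fun n : ℕ => gaussHermite n v g - ∫ x, g x ∂(gaussianReal 0 v)) =O[atTop]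
      fun n : ℕ => (n : ℝ) ^ (-(m : ℝ) / 2) := by
  simp only [gaussHermite_eq_gaussHermite_one _ v,
    integral_gaussianReal_eq_integral_one hg.lipPolyOn.continuous]
  exact (hg.comp_const_mul _).gaussHermite_one_sub_integral_isBigO

theorem TemperedOn.gaussHermite_sub_heatConv_isBigO (hg : TemperedOn m g univ) (hv : v ≠ 0)
    (w : ℝ) : (fun n : ℕ => gaussHermite n v (fun x => g (w - x)) - heatConv v g w) =O[atTop]
      fun n : ℕ => (n : ℝ) ^ (-(m : ℝ) / 2) := by
  rw [heatConv_eq_integral hv]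
  exact (hg.comp_const_sub w).gaussHermite_sub_integral_isBigO

theorem mainTheorem1_general {J : Set ℝ} {F Finv : ℝ → ℝ} (hv : v ≠ 0) (hJ : J.OrdConnected)
    (hJo : IsOpen J) (hF : TemperedOn m F univ) (hFJ : ∀ x, F x ∈ closure J) (hFJ' : ∃ a, F a ∈ J)
    (hFinv : TemperedOn m Finv J) :
    (∀ w y : ℝ,
      MemGaussianSobolev m v (fun x => F (w - y - x)) ∧
      (fun n : ℕ => gaussHermite n v (fun x => F (w - y - x)) - heatConv v F (w - y))
        =O[atTop] fun n : ℕ => (n : ℝ) ^ (-(m : ℝ) / 2)) ∧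
    (∀ z : ℝ, heatConv v F z ∈ J) ∧
    (∀ w : ℝ,
      MemGaussianSobolev m v (fun y => Finv (heatConv v F (w - y))) ∧
      (fun n : ℕ => gaussHermite n v (fun y => Finv (heatConv v F (w - y)))
          - heatConv v (fun z => Finv (heatConv v F z)) w)
        =O[atTop] fun n : ℕ => (n : ℝ) ^ (-(m : ℝ) / 2)) := by
  obtain ⟨a, ha⟩ := hFJ'
  have hmem := heatConv_mem hv hJ hJo hF.lipPolyOn.polyGrowth hF.lipPolyOn.continuous hFJ ha
  have hout : TemperedOn m (fun z => Finv (heatConv v F z)) univ :=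
    hFinv.comp (temperedOn_heatConv hF hv) hmem
  exact ⟨fun w y => ⟨(hF.comp_const_sub (w - y)).memGaussianSobolev,
      hF.gaussHermite_sub_heatConv_isBigO hv (w - y)⟩, hmem,
    fun w => ⟨(hout.comp_const_sub w).memGaussianSobolev,
      hout.gaussHermite_sub_heatConv_isBigO hv w⟩⟩

end Main

theorem mainTheorem1 (m : ℕ) (T₀ T₁ : ℝ) (hT : T₀ < T₁) (v : ℝ≥0) (hv : (v : ℝ) = T₁ - T₀)
    -- `F` is the iterate; `Finv`, on its domain `J`, is the inverse of the marginal CDF at `T₁`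
    (F Finv : ℝ → ℝ) (J : Set ℝ)
    -- the inverse CDF is given on the whole line (extrapolated), or on `(0, 1)` for a CDF `F`
    (hJ : J = Set.univ ∨ (J = Set.Ioo 0 1 ∧ IsCDF F))
    (hF : IsSplineOn m F Set.univ) (hFinv : IsSplineOn m Finv J) :
    -- the inner integrands
    (∀ w y : ℝ,
      MemGaussianSobolev m v (fun x => F (w - y - x)) ∧
      (fun n : ℕ => gaussHermite n v (fun x => F (w - y - x)) - heatConv v F (w - y))
        =O[Filter.atTop] fun n : ℕ => (n : ℝ) ^ (-(m : ℝ) / 2)) ∧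
    -- the outer integrands are well defined
    (∀ z : ℝ, heatConv v F z ∈ J) ∧
    -- the outer integrands
    (∀ w : ℝ,
      MemGaussianSobolev m v (fun y => Finv (heatConv v F (w - y))) ∧
      (fun n : ℕ => gaussHermite n v (fun y => Finv (heatConv v F (w - y)))
          - heatConv v (fun z => Finv (heatConv v F z)) w)
        =O[Filter.atTop] fun n : ℕ => (n : ℝ) ^ (-(m : ℝ) / 2)) := by
  have hv0 : v ≠ 0 := by
    rintro rfl
    exact (sub_pos.2 hT).ne hv
  have hFt : TemperedOn m F Set.univ := hF.temperedOn Set.ordConnected_univ isOpen_univ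
  rcases hJ with rfl | ⟨rfl, hcdf⟩
  · exact mainTheorem1_general hv0 Set.ordConnected_univ isOpen_univ hFt
      (fun _ => subset_closure (Set.mem_univ _)) ⟨0, Set.mem_univ _⟩
      (hFinv.temperedOn Set.ordConnected_univ isOpen_univ)
  · exact mainTheorem1_general hv0 Set.ordConnected_Ioo isOpen_Ioo hFt hcdf.mem_closure_Ioo
      (hcdf.exists_mem_Ioo hFt.lipPolyOn.continuous)
      (hFinv.temperedOn Set.ordConnected_Ioo isOpen_Ioo)
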